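/- **Setting.** Work in first-order logic with equality over an arbitrary signature; equations are taken modulo symmetry. A literal is a ground equality $s=t$ or disequality $s\neq t$. For a finite set $S$ of literals, $\Sigma_S$ is the set of non-logical symbols occurring in $S$ and $S_=$ the set of equalities in $S$. Let $A,B$ be finite sets of literals. A term is $A$-*colorable* ($B$-colorable) if all its symbols are in $\Sigma_A$ ($\Sigma_B$), and $AB$-*colorable* if it is both. An *interpolant* of $A,B$ is a quantifier-free sentence $\varphi$ with non-logical symbols in $\Sigma_A\cap\Sigma_B$ such that $A\models\varphi$ and $B\cup\{\varphi\}$ is unsatisfiable. A *Horn clause* is a clause with at most one positive literal, written as an implication. **Congruence graphs.** Given a set $E$ of equalities and a finite subterm-closed set $T$ of ground terms, congruence closure starts from the edgeless graph on $T$ and repeatedly adds an edge $\langle s,t\rangle$ between vertices $s,t$ that are not yet connected, where either $(s=t)\in E$ (a *basic* edge), or $s=f(u_1,\dots,u_k)$, $t=f(v_1,\dots,v_k)$ and $u_i$ is connected to $v_i$ for every $i$ (a *derived* edge). Any intermediate graph is a *congruence graph* over $E$ and $T$. It is acyclic; $\overline{uv}$ is the unique path between connected $u,v$. The *parent paths*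 of the above derived edge are $\overline{u_iv_i}$, $1\le i\le k$. An edge is *colorable* if both endpoints are $A$-colorable or both are $B$-colorable. A *coloring* of a congruence graph over $(A\cup B)_=$ gives every edge a color in $\{A,B\}$ such that a basic edge colored $X$ belongs to $X$, and an edge colored $X$ has $X$-colorable endpoints. An $X$-*path* is a path all of whose edges are colored $X$; a *factor* of a path is a maximal non-empty subpath with equally colored edges. **Path interpolants.** Write $[\![\pi]\!]$ for the equality of the endpoints of a path $\pi$, and $[\![\pi]\!]=\mathrm{true}$ if $\pi$ is empty (has no edge). For empty $\pi$ put $\mathcal B(\pi)=\varnothing$ and $I(\pi)=\mathrm{true}$. For non-empty $\pi$: $$\mathcal B(\pi)=\begin{cases}\bigcup\{\mathcal B(\sigma):\sigma\text{ a factor of }\pi\}&\pi\text{ has}\ge2\text{ factors}\\ \{\pi\}&\pi\text{ is a }B\text{-path}\\ \bigcup\{\mathcal B(\sigma):\sigma\text{ a parent path of an edge of }\pi\}&\pi\text{ is an }A\text{-path,}\end{cases}$$ $$J(\pi)=\Big(\bigwedge_{\sigma\in\mathcal B(\pi)}[\![\sigma]\!]\Big)\Rightarrow[\![\pi]\!],$$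 $$I(\pi)=\begin{cases}\bigwedge\{I(\sigma):\sigma\text{ a factor of }\pi\}&\pi\text{ has}\ge2\text{ factors}\\ \bigwedge\{I(\sigma):\sigma\text{ a parent path of an edge of }\pi\}&\pi\text{ is a }B\text{-path}\\ J(\pi)\wedge\bigwedge\{I(\sigma):\sigma\in\mathcal B(\pi)\}&\pi\text{ is an }A\text{-path.}\end{cases}$$ Further, write $\pi=\pi_1\theta\pi_2$, where $\theta$ is the largest subpath of $\pi$ with $B$-colorable endpoints, or the empty path at an arbitrary vertex of $\pi$ if no vertex of $\pi$ is $B$-colorable, and put $P=\mathcal B(\pi_1)\cup\mathcal B(\pi_2)$ and $$I'(\pi)=I(\theta)\wedge\bigwedge_{\tau\in P}I(\tau)\wedge\Big(\bigwedge_{\tau\in P}[\![\tau]\!]\Rightarrow\neg[\![\theta]\!]\Big).$$ **The algorithm** (nondeterministic), on inputs $A,B$: 1. Run congruence closure with $E=(A\cup B)_=$ and with $T$ the set of all terms and subterms occurring in $A\cup B$. At any moment at which a disequality $(s\neq t)\in A\cup B$ has connected sides $s,t$, one may choose such a disequality, choose one of the sets $A,B$ that contains it, and go on to the next step with the current graph.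 2. As long as the graph has uncolorable edges, take the first one in the order of introduction. It is a derived edge $\langle f(u_1,\dots,u_k),f(v_1,\dots,v_k)\rangle$. Choose an $AB$-colorable vertex $w_i$ on each parent path $\overline{u_iv_i}$, add the vertex $f(w_1,\dots,w_k)$, and replace the edge in the sequence of edges with $\langle f(u_1,\dots,u_k),f(w_1,\dots,w_k)\rangle$ followed by $\langle f(w_1,\dots,w_k),f(v_1,\dots,v_k)\rangle$; then go through the sequence and drop every edge whose endpoints are already connected by the edges kept before it. When all edges are colorable, choose any coloring. 3. Return $I(\overline{st})$ if the set chosen in step 1 is $B$, and $I'(\overline{st})$ if it is $A$. **Theorem.** Let $A,B$ be finite sets of ground literals such that $A\cup B$ is unsatisfiable. Then: - The algorithm terminates on $A,B$ for all choices: there is no infinite run, all the recursive evaluations of $\mathcal B,I,I'$ in step 3 terminate, and a run never stops without having returned a formula. - Every formula that it returns is an interpolant of $A,B$ and a conjunction of Horn clauses. - More generally, the last step does not depend on how the graph was made colorable: for every finite subterm-closed set $T$, every congruence graph over $(A\cup B)_=$ and $T$ with any coloring, and every disequality $s\neq t$ in $X\in\{A,B\}$ whose sides are connected in the graph, $I(\overline{st})$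 (if $X=B$) or $I'(\overline{st})$ (if $X=A$) is well defined, and it is an interpolant of $A,B$ and a conjunction of Horn clauses. -/

import Mathlib

open FirstOrder FirstOrder.Language

universe u v w

namespace EUF

/-! ### Ground terms, literals and symbols -/

/-- Ground terms: terms without variables. Constants are function symbols of arity `0`. -/
abbrev GTerm (L : FirstOrder.Language.{u, v}) := L.Term Empty

/-- Ground literals of the theory of equality: equalities and disequalities. -/
inductive Literal (L : FirstOrder.Language.{u, v})
  | eq (s t : GTerm L)
  | ne (s t : GTerm L)

/-- The sentence that a literal stands for. -/
def Literal.toSentence {L : FirstOrder.Language.{u, v}} : Literal L → L.Sentence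
  | .eq s t => s.equal t
  | .ne s t => ∼(s.equal t)

/-- A finite set of literals, seen as a set of sentences. -/
def theoryOf {L : FirstOrder.Language.{u, v}} (S : Finset (Literal L)) : L.Theory :=
  {φ | ∃ l ∈ S, φ = l.toSentence}

/-- The equalities in a set of literals. Equations are taken modulo symmetry. -/
def eqns {L : FirstOrder.Language.{u, v}} (S : Finset (Literal L)) : Set (Sym2 (GTerm L)) :=
  {e | ∃ s t, Literal.eq s t ∈ S ∧ e = s(s, t)}

/-- The non-logical symbols that occur in a term. -/
def termSymbols {L : FirstOrder.Language.{u, v}} {α : Type w} : L.Term α → Set L.Symbols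
  | .var _ => ∅
  | .func f ts => {Sum.inl ⟨_, f⟩} ∪ ⋃ i, termSymbols (ts i)

/-- The non-logical symbols that occur in a formula. -/
def formulaSymbols {L : FirstOrder.Language.{u, v}} {α : Type w} :
    {n : ℕ} → L.BoundedFormula α n → Set L.Symbols
  | _, .falsum => ∅
  | _, .equal t₁ t₂ => termSymbols t₁ ∪ termSymbols t₂
  | _, .rel R ts => {Sum.inr ⟨_, R⟩} ∪ ⋃ i, termSymbols (ts i)
  | _, .imp φ ψ => formulaSymbols φ ∪ formulaSymbols ψ
  | _, .all φ => formulaSymbols φ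

/-- The non-logical symbols that occur in a set of literals. -/
def symbolsOf {L : FirstOrder.Language.{u, v}} (S : Finset (Literal L)) : Set L.Symbols :=
  ⋃ l ∈ S, formulaSymbols l.toSentence

open Classical in
/-- The subterms of a ground term, the term itself included. -/
noncomputable def subterms {L : FirstOrder.Language.{u, v}} : GTerm L → Finset (GTerm L)
  | .var x => x.elim
  | .func f ts => insert (.func f ts) (Finset.univ.biUnion fun i => subterms (ts i))

/-- The two sides of the equation in a literal. -/
def Literal.sides {L : FirstOrder.Language.{u, v}} : Literal L → List (GTerm L)
  | .eq s t => [s, t]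
  | .ne s t => [s, t]

open Classical in
/-- All the terms and subterms that occur in a set of literals. -/
noncomputable def termsOf {L : FirstOrder.Language.{u, v}} (S : Finset (Literal L)) : Finset (GTerm L) :=
  S.biUnion fun l => l.sides.toFinset.biUnion subterms

/-- A set of terms that contains all the subterms of its elements. -/
def SubtermClosed {L : FirstOrder.Language.{u, v}} (T : Finset (GTerm L)) : Prop :=
  ∀ t ∈ T, subterms t ⊆ T

/-! ### Interpolants and Horn clauses -/

/-- `φ` is a ground interpolant of `A` and `B`: a quantifier-free sentence over the non-logical
symbols that `A` and `B` share, entailed by `A` and unsatisfiable together with `B`. -/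
def IsInterpolant {L : FirstOrder.Language.{u, v}} (A B : Finset (Literal L)) (φ : L.Sentence) : Prop :=
  BoundedFormula.IsQF φ ∧
    formulaSymbols φ ⊆ symbolsOf A ∩ symbolsOf B ∧
    (theoryOf A ⊨ᵇ φ) ∧
    ¬ (theoryOf B ∪ {φ}).IsSatisfiable

/-- Conjunctions of zero or more ground equalities. -/
inductive IsEqConj {L : FirstOrder.Language.{u, v}} : L.Sentence → Prop
  | top : IsEqConj ⊤
  | eq (s t : GTerm L) : IsEqConj (s.equal t)
  | and {φ ψ : L.Sentence} : IsEqConj φ → IsEqConj ψ → IsEqConj (φ ⊓ ψ)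

/-- Ground Horn clauses (at most one positive literal) in implicational form: the positive literal,
if there is one, is the innermost conclusion. The negation `∼φ` is the implication `φ ⟹ ⊥`. -/
inductive IsHornClause {L : FirstOrder.Language.{u, v}} : L.Sentence → Prop
  | bot : IsHornClause ⊥
  | eq (s t : GTerm L) : IsHornClause (s.equal t)
  | imp {φ ψ : L.Sentence} : IsEqConj φ → IsHornClause ψ → IsHornClause (φ ⟹ ψ)

/-- Conjunctions of zero or more ground Horn clauses. -/
inductive IsHornConj {L : FirstOrder.Language.{u, v}} : L.Sentence → Prop
  | top : IsHornConj ⊤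
  | clause {φ : L.Sentence} : IsHornClause φ → IsHornConj φ
  | and {φ ψ : L.Sentence} : IsHornConj φ → IsHornConj ψ → IsHornConj (φ ⊓ ψ)

/-! ### Congruence closure and congruence graphs -/

/-- How an edge was introduced: by an equation of the input, or by congruence. -/
inductive EdgeKind
  | basic
  | derived

/-- The undirected graph with the given list of edges. -/
def edgeGraph {L : FirstOrder.Language.{u, v}} (es : List (Sym2 (GTerm L) × EdgeKind)) :
    SimpleGraph (GTerm L) :=
  SimpleGraph.fromEdgeSet {e | ∃ k, (e, k) ∈ es}

/-- A state of the congruence closure algorithm: an undirected graph on a finite set of terms, its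
edges listed in the order of their introduction. -/
structure CGraph (L : FirstOrder.Language.{u, v}) where
  verts : Finset (GTerm L)
  edges : List (Sym2 (GTerm L) × EdgeKind)

/-- The graph itself. Terms outside `G.verts` are isolated vertices of it. -/
def CGraph.graph {L : FirstOrder.Language.{u, v}} (G : CGraph L) : SimpleGraph (GTerm L) :=
  edgeGraph G.edges

/-- One step of congruence closure over the equations `E`: two unconnected vertices are joined by
an edge, either because they are equated in `E` or because they are congruent. -/
def CCStep {L : FirstOrder.Language.{u, v}} (E : Set (Sym2 (GTerm L))) (G G' : CGraph L) : Prop :=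
  ∃ s ∈ G.verts, ∃ t ∈ G.verts, s ≠ t ∧ ¬ G.graph.Reachable s t ∧
    ∃ k : EdgeKind,
      ((k = .basic ∧ s(s, t) ∈ E) ∨
        (k = .derived ∧ ∃ (n : ℕ) (f : L.Functions n) (us vs : Fin n → GTerm L),
          s = Term.func f us ∧ t = Term.func f vs ∧ ∀ i, G.graph.Reachable (us i) (vs i))) ∧
      G' = ⟨G.verts, G.edges ++ [(s(s, t), k)]⟩

/-- `G` is a congruence graph over `E` and the term set `G.verts`: any intermediate graph of
congruence closure. -/
def IsCongruenceGraph {L : FirstOrder.Language.{u, v}} (E : Set (Sym2 (GTerm L))) (G : CGraph L) : Prop :=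
  SubtermClosed G.verts ∧ Relation.ReflTransGen (CCStep E) ⟨G.verts, []⟩ G

/-! ### Colors and colorability -/

/-- The two colors. -/
inductive Color
  | A
  | B

/-- The set of literals that a color stands for. -/
def litsOf {L : FirstOrder.Language.{u, v}} (A B : Finset (Literal L)) : Color → Finset (Literal L)
  | .A => A
  | .B => B

/-- `t` is a term over the symbols that occur in `S`. -/
def Colorable {L : FirstOrder.Language.{u, v}} (S : Finset (Literal L)) (t : GTerm L) : Prop :=
  termSymbols t ⊆ symbolsOf S

/-- An edge is colorable if both its endpoints are `A`-colorable or both are `B`-colorable. -/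
def EdgeColorable {L : FirstOrder.Language.{u, v}} (A B : Finset (Literal L)) (e : Sym2 (GTerm L)) : Prop :=
  ∃ X : Color, ∀ x ∈ e, Colorable (litsOf A B X) x

/-- `c` is a coloring of `G`: a basic edge has the color of a set that it comes from, and an edge
of color `X` has `X`-colorable endpoints. The values of `c` off the edges of `G` play no role. -/
def IsColoring {L : FirstOrder.Language.{u, v}} (A B : Finset (Literal L)) (G : CGraph L)
    (c : Sym2 (GTerm L) → Color) : Prop :=
  ∀ e k, (e, k) ∈ G.edges →
    (k = .basic → e ∈ eqns (litsOf A B (c e))) ∧ ∀ x ∈ e, Colorable (litsOf A B (c e)) x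

/-! ### Paths and factors

A path of a congruence graph is given by the list of its vertices. -/

/-- `π` is the path from `x` to `y` in `G`. -/
def IsPathBetween {L : FirstOrder.Language.{u, v}} (G : CGraph L) (x y : GTerm L) (π : List (GTerm L)) :
    Prop :=
  ∃ p : G.graph.Walk x y, p.IsPath ∧ π = p.support

/-- All edges of `π` have the color `X`. -/
def Mono {L : FirstOrder.Language.{u, v}} (c : Sym2 (GTerm L) → Color) (X : Color) (π : List (GTerm L)) :
    Prop :=
  ∀ x y, [x, y] <:+: π → c s(x, y) = X

/-- `σ` is a factor of `π`: a maximal nonempty subpath with equally colored edges. -/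
def IsFactor {L : FirstOrder.Language.{u, v}} (c : Sym2 (GTerm L) → Color) (σ π : List (GTerm L)) : Prop :=
  2 ≤ σ.length ∧ σ <:+: π ∧ (∃ X, Mono c X σ) ∧
    ∀ τ, τ <:+: π → σ <:+: τ → (∃ X, Mono c X τ) → τ = σ

/-- `σ` is a parent path of an edge of `π`, both traversed in the direction of `π`. -/
def IsParent {L : FirstOrder.Language.{u, v}} (G : CGraph L) (σ π : List (GTerm L)) : Prop :=
  ∃ (n : ℕ) (f : L.Functions n) (us vs : Fin n → GTerm L) (i : Fin n),
    [Term.func f us, Term.func f vs] <:+: π ∧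
    (s(Term.func f us, Term.func f vs), EdgeKind.derived) ∈ G.edges ∧
    IsPathBetween G (us i) (vs i) σ

/-- The equality between the endpoints of a path; it is `⊤` for an empty path. -/
def summary {L : FirstOrder.Language.{u, v}} : List (GTerm L) → L.Sentence
  | [] => ⊤
  | [_] => ⊤
  | x :: y :: l => x.equal ((y :: l).getLast (List.cons_ne_nil y l))

/-- The conjunction of the formulas `F σ` for the paths `σ` in the finite set `P`. -/
noncomputable def conj {L : FirstOrder.Language.{u, v}} (P : Finset (List (GTerm L)))
    (F : List (GTerm L) → L.Sentence) : L.Sentence :=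
  BoundedFormula.iInf fun σ : P => F σ

/-! ### The recursive functions of the interpolation algorithm

Each recursive function is given by its evaluation relation, with one constructor for each of its
defining equations: an evaluation is derivable exactly if all the recursive calls return. -/

open Classical in
/-- `Premises G c π P`: the evaluation of the set of `B`-premises of the path `π` returns `P`. -/
inductive Premises {L : FirstOrder.Language.{u, v}} (G : CGraph L) (c : Sym2 (GTerm L) → Color) :
    List (GTerm L) → Finset (List (GTerm L)) → Prop
  | empty (x : GTerm L) : Premises G c [x] ∅
  | factors (π : List (GTerm L)) (Q : Finset (List (GTerm L)))
      (F : List (GTerm L) → Finset (List (GTerm L)))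
      (hQ : ∀ σ, σ ∈ Q ↔ IsFactor c σ π) (h2 : 2 ≤ Q.card)
      (hF : ∀ σ ∈ Q, Premises G c σ (F σ)) : Premises G c π (Q.biUnion F)
  | pathB (π : List (GTerm L)) (hne : 2 ≤ π.length) (hB : Mono c .B π) : Premises G c π {π}
  | pathA (π : List (GTerm L)) (Q : Finset (List (GTerm L)))
      (F : List (GTerm L) → Finset (List (GTerm L)))
      (hne : 2 ≤ π.length) (hA : Mono c .A π) (hQ : ∀ σ, σ ∈ Q ↔ IsParent G σ π)
      (hF : ∀ σ ∈ Q, Premises G c σ (F σ)) : Premises G c π (Q.biUnion F)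

/-- The `A`-justification of `π`, when `P` is its set of `B`-premises. -/
noncomputable def justification {L : FirstOrder.Language.{u, v}} (P : Finset (List (GTerm L)))
    (π : List (GTerm L)) : L.Sentence :=
  conj P summary ⟹ summary π

/-- `PathInterp G c π φ`: the evaluation of the path interpolant `I(π)` returns `φ`. -/
inductive PathInterp {L : FirstOrder.Language.{u, v}} (G : CGraph L) (c : Sym2 (GTerm L) → Color) :
    List (GTerm L) → L.Sentence → Prop
  | empty (x : GTerm L) : PathInterp G c [x] ⊤
  | factors (π : List (GTerm L)) (Q : Finset (List (GTerm L))) (F : List (GTerm L) → L.Sentence)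
      (hQ : ∀ σ, σ ∈ Q ↔ IsFactor c σ π) (h2 : 2 ≤ Q.card)
      (hF : ∀ σ ∈ Q, PathInterp G c σ (F σ)) : PathInterp G c π (conj Q F)
  | pathB (π : List (GTerm L)) (Q : Finset (List (GTerm L))) (F : List (GTerm L) → L.Sentence)
      (hne : 2 ≤ π.length) (hB : Mono c .B π) (hQ : ∀ σ, σ ∈ Q ↔ IsParent G σ π)
      (hF : ∀ σ ∈ Q, PathInterp G c σ (F σ)) : PathInterp G c π (conj Q F)
  | pathA (π : List (GTerm L)) (P : Finset (List (GTerm L))) (F : List (GTerm L) → L.Sentence)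
      (hne : 2 ≤ π.length) (hA : Mono c .A π) (hP : Premises G c π P)
      (hF : ∀ σ ∈ P, PathInterp G c σ (F σ)) :
      PathInterp G c π (justification P π ⊓ conj P F)

/-- The decomposition `π = π₁θπ₂`: `θ` is the largest subpath of `π` with `B`-colorable endpoints,
or an empty path at any vertex of `π` if no vertex of `π` is `B`-colorable. Consecutive parts share
a vertex. -/
def IsSplit {L : FirstOrder.Language.{u, v}} (B : Finset (Literal L)) (π π₁ θ π₂ : List (GTerm L)) : Prop :=
  (∃ (l r : List (GTerm L)) (x y : GTerm L), π = l ++ θ ++ r ∧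
    θ.head? = some x ∧ θ.getLast? = some y ∧ π₁ = l ++ [x] ∧ π₂ = y :: r) ∧
  ((∃ x ∈ π, Colorable B x) →
    (∀ x ∈ θ.head?, Colorable B x) ∧ (∀ x ∈ θ.getLast?, Colorable B x) ∧
    ∀ τ, τ <:+: π → (∀ x ∈ τ.head?, Colorable B x) → (∀ x ∈ τ.getLast?, Colorable B x) →
      τ <:+: θ) ∧
  ((∀ x ∈ π, ¬ Colorable B x) → θ.length = 1)

open Classical in
/-- `PathInterp' B G c π φ`: the evaluation of the modified path interpolant `I'(π)` returns
`φ`. -/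
inductive PathInterp' {L : FirstOrder.Language.{u, v}} (B : Finset (Literal L)) (G : CGraph L)
    (c : Sym2 (GTerm L) → Color) : List (GTerm L) → L.Sentence → Prop
  | mk (π π₁ θ π₂ : List (GTerm L)) (P₁ P₂ : Finset (List (GTerm L))) (φ : L.Sentence)
      (F : List (GTerm L) → L.Sentence)
      (hsplit : IsSplit B π π₁ θ π₂) (h₁ : Premises G c π₁ P₁) (h₂ : Premises G c π₂ P₂)
      (hφ : PathInterp G c θ φ) (hF : ∀ τ ∈ P₁ ∪ P₂, PathInterp G c τ (F τ)) :
      PathInterp' B G c π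
        (φ ⊓ conj (P₁ ∪ P₂) F ⊓ (conj (P₁ ∪ P₂) summary ⟹ ∼(summary θ)))

/-- The last phase of the algorithm, on the colored graph `G` and a disequality `s ≠ t` from the
set of color `X`: the formula that it returns. -/
def Returns {L : FirstOrder.Language.{u, v}} (B : Finset (Literal L)) (G : CGraph L)
    (c : Sym2 (GTerm L) → Color) (s t : GTerm L) (X : Color) (φ : L.Sentence) : Prop :=
  ∃ π, IsPathBetween G s t π ∧
    ((X = .B ∧ PathInterp G c π φ) ∨ (X = .A ∧ PathInterp' B G c π φ))

/-! ### Making a congruence graph colorable -/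

open Classical in
/-- Go through a list of edges in order, and drop an edge if its endpoints are already connected
by the edges kept so far. -/
noncomputable def prune {L : FirstOrder.Language.{u, v}} (es : List (Sym2 (GTerm L) × EdgeKind)) :
    List (Sym2 (GTerm L) × EdgeKind) :=
  es.foldl (fun acc e =>
    if ∃ x y, e.1 = s(x, y) ∧ (edgeGraph acc).Reachable x y then acc else acc ++ [e]) []

open Classical in
/-- One step that makes `G` more colorable. The first uncolorable edge `⟨f(us), f(vs)⟩` of `G` (in
the order of introduction) is replaced with the edges `⟨f(us), f(ws)⟩` and `⟨f(ws), f(vs)⟩`, where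
`ws i` is any `AB`-colorable vertex on the parent path from `us i` to `vs i`. (If `f(ws)` is a
vertex already, edges can become redundant; these are dropped.) -/
def SplitStep {L : FirstOrder.Language.{u, v}} (A B : Finset (Literal L)) (G G' : CGraph L) : Prop :=
  ∃ (es₁ es₂ : List (Sym2 (GTerm L) × EdgeKind)) (n : ℕ) (f : L.Functions n)
    (us vs ws : Fin n → GTerm L),
    G.edges = es₁ ++ (s(Term.func f us, Term.func f vs), EdgeKind.derived) :: es₂ ∧
    (∀ e ∈ es₁, EdgeColorable A B e.1) ∧
    ¬ EdgeColorable A B s(Term.func f us, Term.func f vs) ∧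
    (∀ i, ∃ π, IsPathBetween G (us i) (vs i) π ∧ ws i ∈ π ∧
      Colorable A (ws i) ∧ Colorable B (ws i)) ∧
    G' = ⟨insert (Term.func f ws) G.verts,
      prune (es₁ ++ (s(Term.func f us, Term.func f ws), EdgeKind.derived) ::
        (s(Term.func f ws, Term.func f vs), EdgeKind.derived) :: es₂)⟩

/-! ### The ground interpolation algorithm, as a transition system -/

/-- States of the algorithm. -/
inductive State (L : FirstOrder.Language.{u, v})
  /-- congruence closure is running -/
  | closing (G : CGraph L)
  /-- a disequality `s ≠ t` from the set of color `X` has been found, with `s` and `t` connected;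
  the graph is being made colorable -/
  | splitting (G : CGraph L) (s t : GTerm L) (X : Color)
  /-- the graph has been colored -/
  | colored (G : CGraph L) (c : Sym2 (GTerm L) → Color) (s t : GTerm L) (X : Color)
  /-- the algorithm has returned `φ` -/
  | returned (φ : L.Sentence)

open Classical in
/-- The steps of the (nondeterministic) algorithm on the inputs `A` and `B`. -/
inductive Step {L : FirstOrder.Language.{u, v}} (A B : Finset (Literal L)) : State L → State L → Prop
  | close (G G' : CGraph L) (h : CCStep (eqns (A ∪ B)) G G') :
      Step A B (.closing G) (.closing G')
  | found (G : CGraph L) (s t : GTerm L) (X : Color) (hst : Literal.ne s t ∈ litsOf A B X)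
      (h : G.graph.Reachable s t) : Step A B (.closing G) (.splitting G s t X)
  | split (G G' : CGraph L) (s t : GTerm L) (X : Color) (h : SplitStep A B G G') :
      Step A B (.splitting G s t X) (.splitting G' s t X)
  | color (G : CGraph L) (c : Sym2 (GTerm L) → Color) (s t : GTerm L) (X : Color)
      (h : IsColoring A B G c) : Step A B (.splitting G s t X) (.colored G c s t X)
  | ret (G : CGraph L) (c : Sym2 (GTerm L) → Color) (s t : GTerm L) (X : Color) (φ : L.Sentence)
      (h : Returns B G c s t X φ) : Step A B (.colored G c s t X) (.returned φ)

open Classical in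
/-- The initial state: the edgeless graph on all the terms and subterms that occur in the input. -/
noncomputable def start {L : FirstOrder.Language.{u, v}} (A B : Finset (Literal L)) : State L :=
  .closing ⟨termsOf (A ∪ B), []⟩

/-- A state that a run of the algorithm on `A` and `B` can reach. -/
def Reaches {L : FirstOrder.Language.{u, v}} (A B : Finset (Literal L)) (q : State L) : Prop :=
  Relation.ReflTransGen (Step A B) (start A B) q

end EUF

/-!
Let `π` be a path of a colored congruence graph, with ends `x` and `y`. In a model of `A`, the
summaries of the `B`-premises of `π` imply `x = y` (`Premises.value_eq`): basic edges of color `A`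
are equations of `A`, derived edges follow from their parent paths by congruence, and a path is the
concatenation of its factors (`eq_of_factors`). Hence all justifications, and with them the path
interpolant `I(π)`, hold in each model of `A` (`PathInterp.realize`). Conversely `I(π)` implies
`x = y` in each model of `B` (`PathInterp.value_eq`), since it provides the justification of each
`A`-path that occurs, and the interpolants of the premises of this justification.

The symbols are shared because of where the colors change. A vertex at which two factors meet lies
on edges of both colors, and the arguments of a colorable term are colorable. So the premises of a
path with `A`-colorable ends have `AB`-colorable ends (`Premises.colorable_ends`), and the
interpolant of a path with `B`-colorable ends has shared symbols only (`PathInterp.symbols_subset`).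
For a disequality of `A`, the ends of the path need not be `B`-colorable. Its middle part has ends
of both colors or is empty (`IsSplit.colorable_ends`), and the premises of the outer parts equate
its ends with those of the whole path.

The recursive functions terminate because the parent paths of an edge consist of edges that were
introduced earlier (`IsParent.pathIn`). This rests on the graph being a forest, in which the path
between two vertices is the one that connected them first.

As for the algorithm, if congruence closure cannot proceed and separates the sides of each
disequality, then the connected components form a model (`ccStep_or_reachable`). A first uncolorable
edge can be split, as its parent paths have colorable edges and lead from one color to the other
(`exists_AB_colorable`). The new edges are colorable, and without the redundant edges the graph is
again a congruence graph (`SplitStep.spec`). So the number of uncolorable edges decreases, and what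
was said about colored congruence graphs applies to the graphs that the algorithm produces.
-/

namespace EUF

variable {L : FirstOrder.Language.{u, v}}

/-! ### Semantics and syntax of the formulas involved -/

section Logic

variable {M : Type w} [L.Structure M]

/-- The value of a ground term in a structure. -/
def value (M : Type w) [L.Structure M] (t : GTerm L) : M :=
  t.realize (default : Empty → M)

theorem value_func {n : ℕ} (f : L.Functions n) (ts : Fin n → GTerm L) :
    value M (Term.func f ts) = Structure.funMap f fun i => value M (ts i) := rfl

theorem realize_equal_iff (s t : GTerm L) :
    M ⊨ (s.equal t : L.Sentence) ↔ value M s = value M t :=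
  Formula.realize_equal

theorem realize_top : M ⊨ (⊤ : L.Sentence) := by
  simp [Sentence.Realize, Formula.Realize]

theorem realize_inf_iff (φ ψ : L.Sentence) : M ⊨ (φ ⊓ ψ : L.Sentence) ↔ M ⊨ φ ∧ M ⊨ ψ := by
  simp [Sentence.Realize, Formula.Realize]

theorem realize_imp_iff (φ ψ : L.Sentence) : M ⊨ (φ ⟹ ψ : L.Sentence) ↔ (M ⊨ φ → M ⊨ ψ) := by
  simp [Sentence.Realize, Formula.Realize]

theorem realize_conj_iff (P : Finset (List (GTerm L))) (F : List (GTerm L) → L.Sentence) :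
    M ⊨ conj P F ↔ ∀ σ ∈ P, M ⊨ F σ := by
  simp [conj, Sentence.Realize, Formula.Realize, BoundedFormula.realize_iInf]

theorem realize_not_iff (φ : L.Sentence) : M ⊨ (∼φ : L.Sentence) ↔ ¬ M ⊨ φ := by
  simp [Sentence.Realize, Formula.Realize]

theorem model_theoryOf_iff (S : Finset (Literal L)) :
    M ⊨ theoryOf S ↔ (∀ s t, Literal.eq s t ∈ S → value M s = value M t) ∧
      ∀ s t, Literal.ne s t ∈ S → value M s ≠ value M t := by
  rw [Theory.model_iff]
  constructor
  · intro h
    refine ⟨fun s t hst => ?_, fun s t hst => ?_⟩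
    · exact (realize_equal_iff s t).1 (h _ ⟨_, hst, rfl⟩)
    · have := h _ ⟨_, hst, rfl⟩
      rw [Literal.toSentence, realize_not_iff, realize_equal_iff] at this
      exact this
  · rintro ⟨h₁, h₂⟩ φ ⟨l, hl, rfl⟩
    cases l with
    | eq s t => exact (realize_equal_iff s t).2 (h₁ s t hl)
    | ne s t =>
      rw [Literal.toSentence, realize_not_iff, realize_equal_iff]
      exact h₂ s t hl

theorem value_eq_of_mem_eqns {S : Finset (Literal L)} (hM : M ⊨ theoryOf S) {s t : GTerm L}
    (h : s(s, t) ∈ eqns S) : value M s = value M t := by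
  obtain ⟨a, b, hab, he⟩ := h
  have := ((model_theoryOf_iff S).1 hM).1 a b hab
  rcases Sym2.eq_iff.1 he with ⟨rfl, rfl⟩ | ⟨rfl, rfl⟩
  · exact this
  · exact this.symm

end Logic

theorem conj_induction {p : L.Sentence → Prop} (htop : p ⊤)
    (hinf : ∀ {φ ψ : L.Sentence}, p φ → p ψ → p (φ ⊓ ψ)) {P : Finset (List (GTerm L))}
    {F : List (GTerm L) → L.Sentence} (h : ∀ σ ∈ P, p (F σ)) : p (conj P F) := by
  rw [conj, BoundedFormula.iInf]
  generalize hl : Finset.toList _ = l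
  clear hl
  induction l with
  | nil => exact htop
  | cons a l ih => exact hinf (h a a.2) ih

theorem isQF_equal (s t : GTerm L) : BoundedFormula.IsQF (s.equal t : L.Sentence) :=
  (BoundedFormula.IsAtomic.equal _ _).isQF

theorem IsEqConj.isQF {φ : L.Sentence} (h : IsEqConj φ) : BoundedFormula.IsQF φ := by
  induction h with
  | top => exact BoundedFormula.IsQF.top
  | eq s t => exact isQF_equal s t
  | and _ _ h₁ h₂ => exact h₁.inf h₂

theorem IsHornClause.isQF {φ : L.Sentence} (h : IsHornClause φ) : BoundedFormula.IsQF φ := by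
  induction h with
  | bot => exact BoundedFormula.isQF_bot
  | eq s t => exact isQF_equal s t
  | imp h₁ _ h₂ => exact h₁.isQF.imp h₂

theorem IsHornConj.isQF {φ : L.Sentence} (h : IsHornConj φ) : BoundedFormula.IsQF φ := by
  induction h with
  | top => exact BoundedFormula.IsQF.top
  | clause h => exact h.isQF
  | and _ _ h₁ h₂ => exact h₁.inf h₂

theorem isEqConj_summary (π : List (GTerm L)) : IsEqConj (summary π) := by
  match π with
  | [] => exact .top
  | [_] => exact .top
  | x :: y :: l => exact .eq _ _

theorem isEqConj_conj_summary (P : Finset (List (GTerm L))) : IsEqConj (conj P summary) :=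
  conj_induction .top .and fun σ _ => isEqConj_summary σ

theorem isHornConj_conj {P : Finset (List (GTerm L))} {F : List (GTerm L) → L.Sentence}
    (h : ∀ σ ∈ P, IsHornConj (F σ)) : IsHornConj (conj P F) :=
  conj_induction .top .and h

theorem isHornConj_justification (P : Finset (List (GTerm L))) {π : List (GTerm L)}
    (hπ : 2 ≤ π.length) : IsHornConj (justification P π) := by
  match π, hπ with
  | x :: y :: l, _ => exact .clause (.imp (isEqConj_conj_summary P) (.eq _ _))

theorem formulaSymbols_top : formulaSymbols (⊤ : L.Sentence) = ∅ :=
  Set.union_self _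

theorem formulaSymbols_inf (φ ψ : L.Sentence) :
    formulaSymbols (φ ⊓ ψ) = formulaSymbols φ ∪ formulaSymbols ψ := by
  change (formulaSymbols φ ∪ (formulaSymbols ψ ∪ ∅)) ∪ ∅ = _
  simp

theorem formulaSymbols_not (φ : L.Sentence) : formulaSymbols (∼φ) = formulaSymbols φ :=
  Set.union_empty _

theorem formulaSymbols_imp (φ ψ : L.Sentence) :
    formulaSymbols (φ ⟹ ψ) = formulaSymbols φ ∪ formulaSymbols ψ := rfl

theorem termSymbols_relabel {α β : Type*} (g : α → β) (t : L.Term α) :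
    termSymbols (t.relabel g) = termSymbols t := by
  induction t with
  | var => rfl
  | func f ts ih => simp [termSymbols, ih]

theorem formulaSymbols_equal (s t : GTerm L) :
    formulaSymbols (s.equal t : L.Sentence) = termSymbols s ∪ termSymbols t := by
  change termSymbols (s.relabel _) ∪ termSymbols (t.relabel _) = _
  rw [termSymbols_relabel, termSymbols_relabel]

theorem formulaSymbols_conj_subset {P : Finset (List (GTerm L))}
    {F : List (GTerm L) → L.Sentence} {K : Set L.Symbols}
    (h : ∀ σ ∈ P, formulaSymbols (F σ) ⊆ K) : formulaSymbols (conj P F) ⊆ K := by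
  refine conj_induction (p := fun φ => formulaSymbols φ ⊆ K) ?_ (fun {φ ψ} h₁ h₂ => ?_) h
  · rw [formulaSymbols_top]; exact Set.empty_subset _
  · rw [formulaSymbols_inf]; exact Set.union_subset h₁ h₂

theorem colorable_of_mem_literal {S : Finset (Literal L)} {l : Literal L} (hl : l ∈ S)
    {t : GTerm L} (ht : t ∈ l.sides) : Colorable S t := by
  have h : termSymbols t ⊆ formulaSymbols l.toSentence := by
    cases l with
    | eq a b =>
      rw [Literal.toSentence, formulaSymbols_equal]
      simp only [Literal.sides, List.mem_cons, List.not_mem_nil, or_false] at ht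
      rcases ht with rfl | rfl
      · exact Set.subset_union_left
      · exact Set.subset_union_right
    | ne a b =>
      rw [Literal.toSentence, formulaSymbols_not, formulaSymbols_equal]
      simp only [Literal.sides, List.mem_cons, List.not_mem_nil, or_false] at ht
      rcases ht with rfl | rfl
      · exact Set.subset_union_left
      · exact Set.subset_union_right
  exact h.trans (Set.subset_biUnion_of_mem (u := fun l => formulaSymbols l.toSentence) hl)

theorem colorable_of_mem_eqns {S : Finset (Literal L)} {e : Sym2 (GTerm L)} (he : e ∈ eqns S)
    {t : GTerm L} (ht : t ∈ e) : Colorable S t := by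
  obtain ⟨a, b, hab, rfl⟩ := he
  exact colorable_of_mem_literal hab (by simpa [Literal.sides] using ht)

theorem colorable_func_iff {S : Finset (Literal L)} {n : ℕ} {f : L.Functions n}
    {ts : Fin n → GTerm L} :
    Colorable S (Term.func f ts) ↔ Sum.inl ⟨n, f⟩ ∈ symbolsOf S ∧ ∀ i, Colorable S (ts i) := by
  simp [Colorable, termSymbols, Set.subset_def]
  grind

/-- `Ends π x y`: the list `π` of vertices starts with `x` and stops with `y`. -/
def Ends (π : List (GTerm L)) (x y : GTerm L) : Prop :=
  π.head? = some x ∧ π.getLast? = some y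

theorem realize_summary_iff {M : Type w} [L.Structure M] {π : List (GTerm L)} {x y : GTerm L}
    (h : Ends π x y) : M ⊨ summary π ↔ value M x = value M y := by
  obtain ⟨h₁, h₂⟩ := h
  match π with
  | [] => simp at h₁
  | [z] =>
    simp only [List.head?_cons, Option.some.injEq, List.getLast?_singleton] at h₁ h₂
    subst h₁ h₂
    simp [summary]
  | a :: b :: l =>
    simp only [List.head?_cons, Option.some.injEq] at h₁
    rw [List.getLast?_cons_cons, List.getLast?_eq_some_getLast (List.cons_ne_nil b l),
      Option.some.injEq] at h₂
    subst h₁ h₂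
    exact realize_equal_iff _ _

theorem formulaSymbols_summary_subset {K : Set L.Symbols} {π : List (GTerm L)} {x y : GTerm L}
    (h : Ends π x y) (hx : termSymbols x ⊆ K) (hy : termSymbols y ⊆ K) :
    formulaSymbols (summary π) ⊆ K := by
  obtain ⟨h₁, h₂⟩ := h
  match π with
  | [] => exact formulaSymbols_top.trans_subset (Set.empty_subset _)
  | [z] => exact formulaSymbols_top.trans_subset (Set.empty_subset _)
  | a :: b :: l =>
    simp only [List.head?_cons, Option.some.injEq] at h₁
    rw [List.getLast?_cons_cons, List.getLast?_eq_some_getLast (List.cons_ne_nil b l),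
      Option.some.injEq] at h₂
    subst h₁ h₂
    rw [summary, formulaSymbols_equal]
    exact Set.union_subset hx hy

/-! ### Paths as lists of vertices, and their factors -/

theorem ends_reverse {π : List (GTerm L)} {x y : GTerm L} (h : Ends π x y) :
    Ends π.reverse y x := by
  simpa [Ends, and_comm] using h

theorem exists_ends {π : List (GTerm L)} (h : π ≠ []) : ∃ x y, Ends π x y :=
  ⟨_, _, List.head?_eq_some_head h, List.getLast?_eq_some_getLast h⟩

theorem pair_infix_reverse {x y : GTerm L} {π : List (GTerm L)} :
    [x, y] <:+: π.reverse ↔ [y, x] <:+: π := by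
  rw [← List.reverse_infix]
  simp

theorem mono_reverse {c : Sym2 (GTerm L) → Color} {X : Color} {π : List (GTerm L)}
    (h : Mono c X π) : Mono c X π.reverse := fun x y hxy => by
  rw [Sym2.eq_swap]
  exact h y x (pair_infix_reverse.1 hxy)

theorem isFactor_reverse {c : Sym2 (GTerm L) → Color} {σ π : List (GTerm L)}
    (h : IsFactor c σ π) : IsFactor c σ.reverse π.reverse := by
  obtain ⟨h2, hi, ⟨X, hX⟩, hmax⟩ := h
  refine ⟨by simpa using h2, List.reverse_infix.2 hi, ⟨X, mono_reverse hX⟩, ?_⟩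
  rintro τ hτ hστ ⟨Y, hY⟩
  have := hmax τ.reverse (by rw [← List.reverse_infix]; simpa using hτ)
    (by rw [← List.reverse_infix]; simpa using hστ) ⟨Y, mono_reverse hY⟩
  rw [← this, List.reverse_reverse]

theorem mono_cons_cons {c : Sym2 (GTerm L) → Color} {X : Color} {z x : GTerm L}
    {s : List (GTerm L)} (hs : Mono c X (x :: s)) (hz : c s(z, x) = X) :
    Mono c X (z :: x :: s) := by
  intro a b hab
  rcases List.infix_cons_iff.1 hab with h | h
  · simp only [List.cons_prefix_cons] at h
    obtain ⟨rfl, rfl, -⟩ := h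
    exact hz
  · exact hs a b h

theorem finite_infixes (π : List (GTerm L)) : {σ | σ <:+: π}.Finite := by
  refine (List.finite_toSet π.sublists).subset fun σ (hσ : σ <:+: π) => ?_
  exact List.mem_sublists.2 hσ.sublist

theorem finite_factors (c : Sym2 (GTerm L) → Color) (π : List (GTerm L)) :
    {σ | IsFactor c σ π}.Finite :=
  (finite_infixes π).subset fun _ h => h.2.1

/-- Every edge of a list lies on a factor. -/
theorem exists_isFactor (c : Sym2 (GTerm L) → Color) {π : List (GTerm L)} {x y : GTerm L}
    (h : [x, y] <:+: π) : ∃ σ, IsFactor c σ π ∧ [x, y] <:+: σ := by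
  have hmono : Mono c (c s(x, y)) [x, y] := by
    intro a b hab
    have := hab.eq_of_length_le (by simp)
    simp only [List.cons.injEq, and_true] at this
    obtain ⟨rfl, rfl⟩ := this
    rfl
  have hfin : {σ | σ <:+: π ∧ [x, y] <:+: σ ∧ ∃ X, Mono c X σ}.Finite :=
    (finite_infixes π).subset fun _ h => h.1
  obtain ⟨σ, ⟨h₁, h₂, h₃⟩, hmax⟩ :=
    hfin.exists_maximalFor List.length _ ⟨[x, y], h, List.infix_rfl, _, hmono⟩
  refine ⟨σ, ⟨h₂.length_le, h₁, h₃, fun τ hτ hστ hτX => ?_⟩, h₂⟩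
  exact (hστ.eq_of_length_le (hmax ⟨hτ, h₂.trans hστ, hτX⟩ hστ.length_le)).symm

theorem two_le_card_factors {c : Sym2 (GTerm L) → Color} {π : List (GTerm L)}
    {Q : Finset (List (GTerm L))} (hQ : ∀ σ, σ ∈ Q ↔ IsFactor c σ π) (hA : ¬ Mono c .A π)
    (hB : ¬ Mono c .B π) : 2 ≤ Q.card := by
  simp only [Mono, not_forall] at hA hB
  obtain ⟨x, y, hxy, hcx⟩ := hA
  obtain ⟨z, w, hzw, hcz⟩ := hB
  obtain ⟨σ, hσ, hxyσ⟩ := exists_isFactor c hxy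
  obtain ⟨τ, hτ, hzwτ⟩ := exists_isFactor c hzw
  refine Finset.one_lt_card.2 ⟨σ, (hQ σ).2 hσ, τ, (hQ τ).2 hτ, ?_⟩
  rintro rfl
  obtain ⟨X, hX⟩ := hσ.2.2.1
  have h₁ := hX x y hxyσ
  have h₂ := hX z w hzwτ
  cases X
  · exact hcx h₁
  · exact hcz h₂

/-- The edge before a factor has the other color. -/
theorem IsFactor.color_ne {c : Sym2 (GTerm L) → Color} {X : Color} {z x : GTerm L}
    {s π l r : List (GTerm L)} (h : IsFactor c (x :: s) π) (hX : Mono c X (x :: s))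
    (hπ : π = l ++ z :: x :: s ++ r) : c s(z, x) ≠ X := by
  intro hc
  have := h.2.2.2 (z :: x :: s) ⟨l, r, by simp [hπ]⟩ ⟨[z], [], by simp⟩
    ⟨X, mono_cons_cons hX hc⟩
  simpa using congrArg List.length this

/-- If the vertices on the edges of color `X` have the property `p`, then `p` passes from the first
vertex of a path to the first vertex of each factor: unless the factor starts the path, its first
vertex lies on edges of both colors. -/
theorem IsFactor.head_prop {c : Sym2 (GTerm L) → Color} {X : Color} {p : GTerm L → Prop}
    {σ π : List (GTerm L)} {a b x y : GTerm L} (h : IsFactor c σ π) (hπ : Ends π a b)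
    (hσ : Ends σ x y) (ha : p a)
    (hp : ∀ u v, [u, v] <:+: π → c s(u, v) = X → p u ∧ p v) : p x := by
  obtain ⟨Y, hY⟩ := h.2.2.1
  match σ, h.1 with
  | x' :: x'' :: s, _ =>
    obtain rfl : x' = x := by simpa using hσ.1
    by_cases hXY : Y = X
    · subst hXY
      have hi : [x', x''] <:+: x' :: x'' :: s := ⟨[], s, by simp⟩
      exact (hp x' x'' (hi.trans h.2.1) (hY _ _ hi)).1
    · obtain ⟨l, r, hlr⟩ := h.2.1
      rcases List.eq_nil_or_concat l with rfl | ⟨l', z, rfl⟩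
      · have := hπ.1
        simp only [← hlr, List.nil_append, List.cons_append, List.head?_cons,
          Option.some.injEq] at this
        exact this ▸ ha
      · have hne := h.color_ne hY (z := z) (l := l') (r := r) (by simp [← hlr])
        refine (hp z x' ⟨l', x'' :: s ++ r, by simp [← hlr]⟩ ?_).2
        generalize c s(z, x') = Z at hne
        cases X <;> cases Y <;> cases Z <;> simp_all

theorem IsFactor.ends_prop {c : Sym2 (GTerm L) → Color} {X : Color} {p : GTerm L → Prop}
    {σ π : List (GTerm L)} {a b x y : GTerm L} (h : IsFactor c σ π) (hπ : Ends π a b)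
    (hσ : Ends σ x y) (ha : p a) (hb : p b)
    (hp : ∀ u v, [u, v] <:+: π → c s(u, v) = X → p u ∧ p v) : p x ∧ p y := by
  refine ⟨h.head_prop hπ hσ ha hp, ?_⟩
  refine (isFactor_reverse h).head_prop (X := X) (ends_reverse hπ) (ends_reverse hσ) hb ?_
  intro u v huv hc
  exact (hp v u (pair_infix_reverse.1 huv) (by rwa [Sym2.eq_swap])).symm

theorem eq_of_edges {β : Type w} (f : GTerm L → β) {π : List (GTerm L)} {a b : GTerm L}
    (hπ : Ends π a b) (h : ∀ x y, [x, y] <:+: π → f x = f y) : f a = f b := by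
  induction π generalizing a with
  | nil => simp [Ends] at hπ
  | cons x l ih =>
    obtain ⟨h₁, h₂⟩ := hπ
    obtain rfl : x = a := by simpa using h₁
    rcases l with _ | ⟨y, l⟩
    · obtain rfl : x = b := by simpa using h₂
      rfl
    · refine (h x y ⟨[], l, by simp⟩).trans (ih ⟨rfl, by simpa using h₂⟩ fun u v huv => ?_)
      exact h u v (huv.trans (List.infix_cons List.infix_rfl))

/-- A path without repetitions is the concatenation of its factors. So a function that takes the
same value at the two ends of each factor takes the same value at the ends of the path. -/
theorem eq_of_factors {β : Type w} (f : GTerm L → β) {c : Sym2 (GTerm L) → Color}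
    {π : List (GTerm L)} (hnd : π.Nodup) {a b : GTerm L} (hπ : Ends π a b)
    (h : ∀ σ x y, IsFactor c σ π → Ends σ x y → f x = f y) : f a = f b := by
  -- Induction on the length of the rest `x :: l` of the path. The condition on the colors says that
  -- a factor starts at `x`.
  have key : ∀ n (p l : List (GTerm L)) (x : GTerm L), l.length ≤ n → π = p ++ x :: l →
      (∀ z y, p.getLast? = some z → l.head? = some y → c s(z, x) ≠ c s(x, y)) → f x = f b := by
    intro n
    induction n with
    | zero =>
      intro p l x hl hp _
      obtain rfl : l = [] := by simpa using hl
      have := hπ.2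
      rw [hp] at this
      obtain rfl : x = b := by simpa using this
      rfl
    | succ n ih =>
      intro p l x hl hp hc
      rcases l with _ | ⟨y, l⟩
      · have := hπ.2
        rw [hp] at this
        obtain rfl : x = b := by simpa using this
        rfl
      obtain ⟨σ, hσ, s₁, s₂, rfl⟩ := exists_isFactor c (π := π) (x := x) (y := y)
        ⟨p, l, by simp [hp]⟩
      obtain ⟨X, hX⟩ := hσ.2.2.1
      obtain ⟨r₁, r₂, hr⟩ := hσ.2.1
      have heq : p ++ x :: (y :: l) = (r₁ ++ s₁) ++ x :: (y :: (s₂ ++ r₂)) := by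
        rw [← hp, ← hr]; simp
      have hnd₁ := hp ▸ hnd
      have hnd₂ : ((r₁ ++ s₁) ++ x :: (y :: (s₂ ++ r₂))).Nodup := by rw [← heq]; exact hnd₁
      obtain ⟨hp₁, hl₁⟩ : p = r₁ ++ s₁ ∧ y :: l = y :: (s₂ ++ r₂) := by
        have := (List.append_cons_inj_of_notMem (x₁ := p) (z₁ := y :: l) (x₂ := r₁ ++ s₁)
          (z₂ := y :: (s₂ ++ r₂)) (a₁ := x) (a₂ := x) ?_ ?_).1 heq
        · exact ⟨this.1, this.2.2⟩
        · grind
        · grind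
      have hxy : c s(x, y) = X := hX _ _ ⟨s₁, s₂, rfl⟩
      obtain rfl : s₁ = [] := by
        rcases List.eq_nil_or_concat s₁ with h | ⟨s, z, rfl⟩
        · exact h
        · refine absurd ?_ (hc z y (by rw [hp₁]; simp) rfl)
          rw [hxy]
          exact hX _ _ ⟨s, y :: s₂, by simp⟩
      rw [List.nil_append] at hX hσ hr
      obtain ⟨q, w, hqw⟩ : ∃ q w, [x, y] ++ s₂ = (x :: q) ++ [w] := by
        rcases List.eq_nil_or_concat (y :: s₂) with h | ⟨q, w, h⟩
        · simp at h
        · exact ⟨q, w, by simpa using h⟩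
      have hπ' : π = (p ++ x :: q) ++ w :: r₂ := by
        rw [← hr, hqw, hp₁]; simp
      refine (h _ x w hσ ⟨by simp, by rw [hqw, List.getLast?_concat]⟩).trans (ih (p ++ x :: q) r₂ w ?_ hπ' ?_)
      · have := congrArg List.length hl₁
        simp at this hl
        omega
      · intro z v hz hv hzv
        obtain ⟨r, rfl⟩ : ∃ r, r₂ = v :: r := by
          cases r₂ with
          | nil => simp at hv
          | cons a r => exact ⟨r, by simpa using hv⟩
        obtain ⟨q', hq'⟩ : ∃ q', x :: q = q' ++ [z] := by
          rcases List.eq_nil_or_concat (x :: q) with h | ⟨q', z', h⟩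
          · simp at h
          · rw [h] at hz
            rw [List.concat_eq_append, ← List.append_assoc, List.getLast?_concat] at hz
            obtain rfl := Option.some.inj hz
            exact ⟨q', by simpa using h⟩
        have hzw : c s(z, w) = X := hX _ _ ⟨q', [], by rw [hqw, hq']; simp⟩
        -- `IsFactor.color_ne` for the reversed path: the edge after `σ` has the other color.
        have hσ' := isFactor_reverse hσ
        have hX' := mono_reverse hX
        rw [hqw, List.reverse_append, List.reverse_singleton, List.singleton_append] at hσ' hX'
        refine hσ'.color_ne hX' (z := v) (l := r.reverse) (r := p.reverse) ?_ ?_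
        · rw [hπ']; simp
        · rw [Sym2.eq_swap, ← hzv, hzw]
  match π, hπ.1 with
  | x :: l, h₁ =>
    obtain rfl : x = a := by simpa using h₁
    exact key _ [] l x le_rfl rfl (by simp)

/-! ### Congruence graphs -/

theorem edgeGraph_adj {es : List (Sym2 (GTerm L) × EdgeKind)} {x y : GTerm L} :
    (edgeGraph es).Adj x y ↔ (∃ k, (s(x, y), k) ∈ es) ∧ x ≠ y :=
  SimpleGraph.fromEdgeSet_adj _

theorem edgeGraph_mono {es es' : List (Sym2 (GTerm L) × EdgeKind)} (h : es ⊆ es') :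
    edgeGraph es ≤ edgeGraph es' := by
  intro x y hxy
  rw [edgeGraph_adj] at hxy ⊢
  obtain ⟨⟨k, hk⟩, hne⟩ := hxy
  exact ⟨⟨k, h hk⟩, hne⟩

theorem reachable_of_mem_edges {es : List (Sym2 (GTerm L) × EdgeKind)} {x y : GTerm L}
    {k : EdgeKind} (h : (s(x, y), k) ∈ es) : (edgeGraph es).Reachable x y := by
  by_cases hxy : x = y
  · exact hxy ▸ SimpleGraph.Reachable.refl x
  · exact SimpleGraph.Adj.reachable (edgeGraph_adj.2 ⟨⟨k, h⟩, hxy⟩)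

theorem edgeGraph_concat (es : List (Sym2 (GTerm L) × EdgeKind)) (x y : GTerm L) (k : EdgeKind) :
    edgeGraph (es ++ [(s(x, y), k)]) = edgeGraph es ⊔ SimpleGraph.edge x y := by
  ext a b
  rw [SimpleGraph.sup_adj, SimpleGraph.edge_adj, edgeGraph_adj, edgeGraph_adj]
  simp only [List.mem_append, List.mem_singleton, Prod.mk.injEq, Sym2.eq_iff]
  grind

theorem reachable_of_adj_reachable {V : Type w} {H K : SimpleGraph V}
    (h : ∀ x y, H.Adj x y → K.Reachable x y) {x y : V} (hxy : H.Reachable x y) :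
    K.Reachable x y := by
  obtain ⟨p⟩ := hxy
  induction p with
  | nil => exact SimpleGraph.Reachable.refl _
  | cons hadj _ ih => exact (h _ _ hadj).trans ih

/-- The edge between `s` and `t` of kind `k` is justified by the equations `E` and the
connections that the edges `es` provide. -/
def Justified (E : Set (Sym2 (GTerm L))) (es : List (Sym2 (GTerm L) × EdgeKind))
    (s t : GTerm L) (k : EdgeKind) : Prop :=
  (k = .basic ∧ s(s, t) ∈ E) ∨
    (k = .derived ∧ ∃ (n : ℕ) (f : L.Functions n) (us vs : Fin n → GTerm L),
      s = Term.func f us ∧ t = Term.func f vs ∧ ∀ i, (edgeGraph es).Reachable (us i) (vs i))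

theorem Justified.mono {E : Set (Sym2 (GTerm L))} {es es' : List (Sym2 (GTerm L) × EdgeKind)}
    {s t : GTerm L} {k : EdgeKind} (h : Justified E es s t k)
    (hes : ∀ x y, (edgeGraph es).Reachable x y → (edgeGraph es').Reachable x y) :
    Justified E es' s t k := by
  rcases h with h | ⟨hk, n, f, us, vs, hs, ht, h⟩
  · exact .inl h
  · exact .inr ⟨hk, n, f, us, vs, hs, ht, fun i => hes _ _ (h i)⟩

theorem Justified.symm {E : Set (Sym2 (GTerm L))} {es : List (Sym2 (GTerm L) × EdgeKind)}
    {s t : GTerm L} {k : EdgeKind} (h : Justified E es s t k) : Justified E es t s k := by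
  rcases h with ⟨hk, h⟩ | ⟨hk, n, f, us, vs, hs, ht, h⟩
  · exact .inl ⟨hk, by rwa [Sym2.eq_swap]⟩
  · exact .inr ⟨hk, n, f, vs, us, ht, hs, fun i => (h i).symm⟩

theorem Justified.reachable_args {E : Set (Sym2 (GTerm L))}
    {es : List (Sym2 (GTerm L) × EdgeKind)} {n : ℕ} {f : L.Functions n} {us vs : Fin n → GTerm L}
    (h : Justified E es (Term.func f us) (Term.func f vs) .derived) (i : Fin n) :
    (edgeGraph es).Reachable (us i) (vs i) := by
  rcases h with ⟨hk, _⟩ | ⟨-, m, g, us', vs', hs, ht, h⟩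
  · cases hk
  · cases hs
    cases ht
    exact h i

/-- Lists of edges between vertices in `V` in which each edge is justified by the preceding ones.
In contrast to congruence graphs, an edge may join vertices that are connected already. -/
inductive Trace (E : Set (Sym2 (GTerm L))) (V : Finset (GTerm L)) :
    List (Sym2 (GTerm L) × EdgeKind) → Prop
  | nil : Trace E V []
  | snoc {es : List (Sym2 (GTerm L) × EdgeKind)} {s t : GTerm L} {k : EdgeKind}
      (h : Trace E V es) (hs : s ∈ V) (ht : t ∈ V) (hj : Justified E es s t k) :
      Trace E V (es ++ [(s(s, t), k)])

theorem Trace.mem_and_justified {E : Set (Sym2 (GTerm L))} {V : Finset (GTerm L)}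
    {es : List (Sym2 (GTerm L) × EdgeKind)} (h : Trace E V es)
    {es₁ es₂ : List (Sym2 (GTerm L) × EdgeKind)} {x y : GTerm L} {k : EdgeKind}
    (hes : es = es₁ ++ (s(x, y), k) :: es₂) :
    Trace E V es₁ ∧ x ∈ V ∧ y ∈ V ∧ Justified E es₁ x y k := by
  induction h generalizing es₂ with
  | nil => simp at hes
  | @snoc es s t k' htr hs ht hj ih =>
    rcases List.eq_nil_or_concat es₂ with rfl | ⟨es₂, e, rfl⟩
    · obtain ⟨rfl, h⟩ := List.append_inj' hes rfl
      simp only [List.cons.injEq, Prod.mk.injEq, and_true] at h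
      obtain ⟨h, rfl⟩ := h
      rcases Sym2.eq_iff.1 h with ⟨rfl, rfl⟩ | ⟨rfl, rfl⟩
      · exact ⟨htr, hs, ht, hj⟩
      · exact ⟨htr, ht, hs, hj.symm⟩
    · rw [List.concat_eq_append, ← List.cons_append, ← List.append_assoc] at hes
      exact ih (List.append_inj' hes rfl).1

theorem trace_and_isAcyclic_of_steps {E : Set (Sym2 (GTerm L))} {V : Finset (GTerm L)}
    {G : CGraph L} (h : Relation.ReflTransGen (CCStep E) ⟨V, []⟩ G) :
    G.verts = V ∧ Trace E V G.edges ∧ G.graph.IsAcyclic ∧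
      ∀ es₁ x y k es₂, G.edges = es₁ ++ (s(x, y), k) :: es₂ →
        ¬ (edgeGraph es₁).Reachable x y := by
  induction h with
  | refl =>
    refine ⟨rfl, .nil, ?_, by simp⟩
    rw [CGraph.graph, show edgeGraph ([] : List (Sym2 (GTerm L) × EdgeKind)) = ⊥ from ?_]
    · exact SimpleGraph.isAcyclic_bot
    · ext x y
      simp [edgeGraph_adj]
  | @tail G G' _ hstep ih =>
    obtain ⟨s, hs, t, ht, -, hst, k, hk, rfl⟩ := hstep
    obtain ⟨rfl, htr, hac, hfresh⟩ := ih
    refine ⟨rfl, htr.snoc hs ht hk, ?_, ?_⟩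
    · rw [CGraph.graph, edgeGraph_concat]
      exact hac.sup_edge_of_not_reachable hst
    · intro es₁ x y k' es₂ hes
      rcases List.eq_nil_or_concat es₂ with rfl | ⟨es₂, e, rfl⟩
      · obtain ⟨rfl, h⟩ := List.append_inj' hes rfl
        simp only [List.cons.injEq, Prod.mk.injEq, and_true] at h
        obtain ⟨h, rfl⟩ := h
        rcases Sym2.eq_iff.1 h with ⟨rfl, rfl⟩ | ⟨rfl, rfl⟩
        · exact hst
        · exact fun h => hst h.symm
      · rw [List.concat_eq_append, ← List.cons_append, ← List.append_assoc] at hes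
        exact hfresh _ _ _ _ _ (List.append_inj' hes rfl).1

theorem IsCongruenceGraph.trace {E : Set (Sym2 (GTerm L))} {G : CGraph L}
    (h : IsCongruenceGraph E G) : Trace E G.verts G.edges :=
  (trace_and_isAcyclic_of_steps h.2).2.1

theorem IsCongruenceGraph.isAcyclic {E : Set (Sym2 (GTerm L))} {G : CGraph L}
    (h : IsCongruenceGraph E G) : G.graph.IsAcyclic :=
  (trace_and_isAcyclic_of_steps h.2).2.2.1

theorem IsCongruenceGraph.not_reachable {E : Set (Sym2 (GTerm L))} {G : CGraph L}
    (h : IsCongruenceGraph E G) {es₁ es₂ : List (Sym2 (GTerm L) × EdgeKind)} {x y : GTerm L}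
    {k : EdgeKind} (hes : G.edges = es₁ ++ (s(x, y), k) :: es₂) :
    ¬ (edgeGraph es₁).Reachable x y :=
  (trace_and_isAcyclic_of_steps h.2).2.2.2 _ _ _ _ _ hes

theorem IsCongruenceGraph.mem_and_justified {E : Set (Sym2 (GTerm L))} {G : CGraph L}
    (h : IsCongruenceGraph E G) {x y : GTerm L} {k : EdgeKind} (he : (s(x, y), k) ∈ G.edges) :
    x ∈ G.verts ∧ y ∈ G.verts ∧ Justified E G.edges x y k := by
  obtain ⟨es₁, es₂, hes⟩ := List.append_of_mem he
  obtain ⟨-, hx, hy, hj⟩ := h.trace.mem_and_justified hes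
  refine ⟨hx, hy, hj.mono fun a b hab => hab.mono (edgeGraph_mono ?_)⟩
  rw [hes]
  exact List.subset_append_left _ _

/-! ### Redundant edges -/

theorem prune_concat (es : List (Sym2 (GTerm L) × EdgeKind)) (x y : GTerm L) (k : EdgeKind) :
    ((edgeGraph (prune es)).Reachable x y ∧ prune (es ++ [(s(x, y), k)]) = prune es) ∨
    (¬ (edgeGraph (prune es)).Reachable x y ∧
      prune (es ++ [(s(x, y), k)]) = prune es ++ [(s(x, y), k)]) := by
  have hiff : (∃ a b, s(x, y) = s(a, b) ∧ (edgeGraph (prune es)).Reachable a b) ↔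
      (edgeGraph (prune es)).Reachable x y := by
    constructor
    · rintro ⟨a, b, h, hr⟩
      rcases Sym2.eq_iff.1 h with ⟨rfl, rfl⟩ | ⟨rfl, rfl⟩
      · exact hr
      · exact hr.symm
    · exact fun h => ⟨x, y, rfl, h⟩
  by_cases h : (edgeGraph (prune es)).Reachable x y
  · refine .inl ⟨h, ?_⟩
    rw [prune, List.foldl_append]
    exact if_pos (hiff.2 h)
  · refine .inr ⟨h, ?_⟩
    rw [prune, List.foldl_append]
    exact if_neg (mt hiff.1 h)

theorem prune_sublist (es : List (Sym2 (GTerm L) × EdgeKind)) : (prune es).Sublist es := by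
  induction es using List.reverseRecOn with
  | nil => exact List.Sublist.refl _
  | append_singleton es e ih =>
    obtain ⟨e, k⟩ := e
    induction e using Sym2.ind with
    | _ x y =>
      rcases prune_concat es x y k with ⟨-, h⟩ | ⟨-, h⟩
      · rw [h]
        exact ih.trans (List.sublist_append_left _ _)
      · rw [h]
        exact ih.append (List.Sublist.refl _)

theorem reachable_prune_iff (es : List (Sym2 (GTerm L) × EdgeKind)) (x y : GTerm L) :
    (edgeGraph (prune es)).Reachable x y ↔ (edgeGraph es).Reachable x y := by
  refine ⟨fun h => h.mono (edgeGraph_mono (prune_sublist es).subset), fun h => ?_⟩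
  refine reachable_of_adj_reachable (fun a b hab => ?_) h
  obtain ⟨⟨k, hk⟩, -⟩ := edgeGraph_adj.1 hab
  clear hab h
  induction es using List.reverseRecOn with
  | nil => simp at hk
  | append_singleton es e ih =>
    obtain ⟨e, k'⟩ := e
    induction e using Sym2.ind with
    | _ c d =>
      have hsub : prune es ⊆ prune (es ++ [(s(c, d), k')]) := by
        rcases prune_concat es c d k' with ⟨-, h⟩ | ⟨-, h⟩
        · rw [h]; exact List.Subset.refl _
        · rw [h]; exact List.subset_append_left _ _
      rcases List.mem_append.1 hk with hk | hk
      · exact (ih hk).mono (edgeGraph_mono hsub)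
      · rw [List.mem_singleton, Prod.mk.injEq] at hk
        have hcd : (edgeGraph (prune (es ++ [(s(c, d), k')]))).Reachable c d := by
          rcases prune_concat es c d k' with ⟨hr, h⟩ | ⟨-, h⟩
          · rw [h]; exact hr
          · rw [h]; exact reachable_of_mem_edges (k := k') (by simp)
        rcases Sym2.eq_iff.1 hk.1 with ⟨rfl, rfl⟩ | ⟨rfl, rfl⟩
        · exact hcd
        · exact hcd.symm

/-- Dropping redundant edges from a trace leaves a congruence graph. -/
theorem Trace.steps_prune {E : Set (Sym2 (GTerm L))} {V : Finset (GTerm L)}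
    {es : List (Sym2 (GTerm L) × EdgeKind)} (h : Trace E V es) :
    Relation.ReflTransGen (CCStep E) ⟨V, []⟩ ⟨V, prune es⟩ := by
  induction h with
  | nil => exact .refl
  | @snoc es s t k _ hs ht hj ih =>
    rcases prune_concat es s t k with ⟨-, h⟩ | ⟨hr, h⟩
    · rw [h]; exact ih
    · rw [h]
      refine ih.tail ⟨s, hs, t, ht, ?_, hr, k, ?_, rfl⟩
      · rintro rfl
        exact hr (SimpleGraph.Reachable.refl _)
      · exact hj.mono fun x y => (reachable_prune_iff es x y).2

/-! ### Paths and parent paths in congruence graphs -/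

/-- `π` is the vertex list of a nonempty sequence of distinct vertices, consecutive ones being
joined by edges from `es`. -/
def PathIn (es : List (Sym2 (GTerm L) × EdgeKind)) (π : List (GTerm L)) : Prop :=
  π.Nodup ∧ π ≠ [] ∧ ∀ x y, [x, y] <:+: π → ∃ k, (s(x, y), k) ∈ es

theorem PathIn.mono {es es' : List (Sym2 (GTerm L) × EdgeKind)} {π : List (GTerm L)}
    (h : PathIn es π) (hes : es ⊆ es') : PathIn es' π :=
  ⟨h.1, h.2.1, fun x y hxy => (h.2.2 x y hxy).imp fun _ hk => hes hk⟩

theorem PathIn.of_infix {es : List (Sym2 (GTerm L) × EdgeKind)} {σ π : List (GTerm L)}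
    (h : PathIn es π) (hσ : σ <:+: π) (hne : σ ≠ []) : PathIn es σ :=
  ⟨hσ.sublist.nodup h.1, hne, fun x y hxy => h.2.2 x y (hxy.trans hσ)⟩

theorem PathIn.factor {c : Sym2 (GTerm L) → Color} {es : List (Sym2 (GTerm L) × EdgeKind)}
    {σ π : List (GTerm L)} (h : PathIn es π) (hσ : IsFactor c σ π) : PathIn es σ :=
  h.of_infix hσ.2.1 fun h0 => by simpa [h0] using hσ.1

theorem IsPathBetween.pathIn {G : CGraph L} {x y : GTerm L} {π : List (GTerm L)}
    (h : IsPathBetween G x y π) : PathIn G.edges π := by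
  obtain ⟨p, hp, rfl⟩ := h
  refine ⟨hp.support_nodup, p.support_ne_nil, fun a b hab => ?_⟩
  have := p.isChain_adj_support.infix hab
  rw [List.isChain_pair] at this
  exact (edgeGraph_adj.1 this).1

theorem IsPathBetween.ends {G : CGraph L} {x y : GTerm L} {π : List (GTerm L)}
    (h : IsPathBetween G x y π) : Ends π x y := by
  obtain ⟨p, -, rfl⟩ := h
  refine ⟨?_, ?_⟩
  · rw [List.head?_eq_some_head p.support_ne_nil, SimpleGraph.Walk.head_support]
  · rw [List.getLast?_eq_some_getLast p.support_ne_nil, SimpleGraph.Walk.getLast_support]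

theorem exists_isPathBetween {G : CGraph L} {x y : GTerm L} (h : G.graph.Reachable x y) :
    ∃ π, IsPathBetween G x y π := by
  obtain ⟨p, hp⟩ := h.exists_isPath
  exact ⟨_, p, hp, rfl⟩

theorem isPathBetween_unique {G : CGraph L} (hG : G.graph.IsAcyclic) {x y : GTerm L}
    {π ρ : List (GTerm L)} (hπ : IsPathBetween G x y π) (hρ : IsPathBetween G x y ρ) : π = ρ := by
  obtain ⟨p, hp, rfl⟩ := hπ
  obtain ⟨q, hq, rfl⟩ := hρ
  exact congrArg (fun r => r.1.support) ((hG.subsingleton_path x y).elim ⟨p, hp⟩ ⟨q, hq⟩)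

/-- In a forest, the path between two vertices that some of the edges connect consists of these
edges. -/
theorem IsPathBetween.pathIn_of_reachable {G : CGraph L} (hG : G.graph.IsAcyclic)
    {es : List (Sym2 (GTerm L) × EdgeKind)} (hes : es ⊆ G.edges) {x y : GTerm L}
    {π : List (GTerm L)} (hπ : IsPathBetween G x y π) (h : (edgeGraph es).Reachable x y) :
    PathIn es π ∧ ∀ z ∈ π, (edgeGraph es).Reachable x z ∧ (edgeGraph es).Reachable z y := by
  obtain ⟨p, hp⟩ := h.exists_isPath
  have hle : edgeGraph es ≤ G.graph := edgeGraph_mono hes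
  obtain rfl : π = p.support := by
    refine isPathBetween_unique hG hπ ⟨p.mapLe hle, hp.mapLe hle, ?_⟩
    simp [SimpleGraph.Walk.mapLe]
  refine ⟨IsPathBetween.pathIn (G := ⟨G.verts, es⟩) ⟨p, hp, rfl⟩, fun z hz => ?_⟩
  classical
  exact ⟨⟨p.takeUntil z hz⟩, ⟨p.dropUntil z hz⟩⟩

theorem finite_parents {G : CGraph L} (hG : G.graph.IsAcyclic) (π : List (GTerm L)) :
    {σ | IsParent G σ π}.Finite := by
  have hfin : ∀ τ : List (GTerm L), {σ | ∃ (n : ℕ) (f : L.Functions n)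
      (us vs : Fin n → GTerm L) (i : Fin n), [Term.func f us, Term.func f vs] = τ ∧
        IsPathBetween G (us i) (vs i) σ}.Finite := by
    intro τ
    by_cases hτ : ∃ (n : ℕ) (f : L.Functions n) (us vs : Fin n → GTerm L),
        [Term.func f us, Term.func f vs] = τ
    · obtain ⟨n, f, us, vs, rfl⟩ := hτ
      refine (Set.finite_iUnion fun i : Fin n => Set.Subsingleton.finite
        (s := {σ | IsPathBetween G (us i) (vs i) σ})
        fun σ hσ ρ hρ => isPathBetween_unique hG hσ hρ).subset ?_
      rintro σ ⟨m, g, us', vs', i, h, hσ⟩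
      simp only [List.cons.injEq, and_true] at h
      obtain ⟨h₁, h₂⟩ := h
      cases h₁
      cases h₂
      exact Set.mem_iUnion.2 ⟨i, hσ⟩
    · refine Set.Finite.subset Set.finite_empty ?_
      rintro σ ⟨n, f, us, vs, i, h, -⟩
      exact hτ ⟨n, f, us, vs, h⟩
  refine ((finite_infixes π).biUnion fun τ _ => hfin τ).subset ?_
  rintro σ ⟨n, f, us, vs, i, hi, -, hσ⟩
  exact Set.mem_biUnion hi ⟨n, f, us, vs, i, rfl, hσ⟩

/-- The parent paths of an edge consist of edges that were introduced before it. -/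
theorem IsParent.pathIn {E : Set (Sym2 (GTerm L))} {G : CGraph L} (hG : IsCongruenceGraph E G)
    {es : List (Sym2 (GTerm L) × EdgeKind)} {e : Sym2 (GTerm L) × EdgeKind}
    (hes : es ++ [e] <+: G.edges) {σ π : List (GTerm L)} (hπ : PathIn (es ++ [e]) π)
    (hσ : IsParent G σ π) : PathIn es σ := by
  obtain ⟨n, f, us, vs, i, hi, he, hp⟩ := hσ
  obtain ⟨a, b, hab⟩ := List.append_of_mem he
  obtain ⟨k, hk⟩ := hπ.2.2 _ _ hi
  have ha : a <+: G.edges := ⟨_, hab.symm⟩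
  have hesG : es <+: G.edges := (List.prefix_append _ _).trans hes
  have hj := (hG.trace.mem_and_justified hab).2.2.2
  have hae : a <+: es := by
    by_contra hcon
    have hlt : es.length < a.length := by
      by_contra hle
      exact hcon (List.prefix_of_prefix_length_le ha hesG (by omega))
    have : es ++ [e] <+: a := List.prefix_of_prefix_length_le hes ha (by simp; omega)
    exact hG.not_reachable hab (reachable_of_mem_edges (this.subset hk))
  exact (hp.pathIn_of_reachable hG.isAcyclic hesG.subset
    ((hj.reachable_args i).mono (edgeGraph_mono hae.subset))).1

/-! ### Termination of the recursive functions -/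

section Evaluation

variable {E : Set (Sym2 (GTerm L))} {G : CGraph L} {c : Sym2 (GTerm L) → Color}

/-- An empty path, a path with edges of one color, or a path with at least two factors. -/
theorem path_cases (c : Sym2 (GTerm L) → Color) {π : List (GTerm L)} (hπ : π ≠ []) :
    (∃ x, π = [x]) ∨ (2 ≤ π.length ∧ ∃ X, Mono c X π) ∨
      ∃ Q : Finset (List (GTerm L)), (∀ σ, σ ∈ Q ↔ IsFactor c σ π) ∧ 2 ≤ Q.card := by
  match π, hπ with
  | [x], _ => exact .inl ⟨x, rfl⟩
  | x :: y :: l, _ =>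
    refine .inr ?_
    by_cases h : ∃ X, Mono c X (x :: y :: l)
    · exact .inl ⟨by simp, h⟩
    · refine .inr ⟨(finite_factors c (x :: y :: l)).toFinset, by simp, ?_⟩
      exact two_le_card_factors (by simp) (fun hA => h ⟨_, hA⟩) (fun hB => h ⟨_, hB⟩)

/-- The premises of a path of color `A` consist of edges that were introduced before the last edge
of the path. This makes the recursion for path interpolants well-founded. -/
theorem exists_premises_of_mono_A (hG : IsCongruenceGraph E G)
    {es : List (Sym2 (GTerm L) × EdgeKind)} {e : Sym2 (GTerm L) × EdgeKind}
    (hes : es ++ [e] <+: G.edges)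
    (ih : ∀ σ, PathIn es σ → ∃ P, Premises G c σ P ∧ ∀ τ ∈ P, PathIn es τ)
    {π : List (GTerm L)} (hπ : PathIn (es ++ [e]) π) (hne : 2 ≤ π.length) (hA : Mono c .A π) :
    ∃ P, Premises G c π P ∧ ∀ τ ∈ P, PathIn es τ := by
  classical
  have hQ : ∀ σ, σ ∈ (finite_parents hG.isAcyclic π).toFinset ↔ IsParent G σ π := by simp
  have := fun σ (hσ : σ ∈ (finite_parents hG.isAcyclic π).toFinset) =>
    ih σ (((hQ σ).1 hσ).pathIn hG hes hπ)
  choose! F hF using this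
  refine ⟨_, .pathA π _ F hne hA hQ fun σ hσ => (hF σ hσ).1, fun τ hτ => ?_⟩
  obtain ⟨σ, hσ, hτσ⟩ := Finset.mem_biUnion.1 hτ
  exact (hF σ hσ).2 τ hτσ

theorem not_two_le_length_of_pathIn_nil {π : List (GTerm L)} (hπ : PathIn [] π) :
    ¬ 2 ≤ π.length := by
  intro h
  match π, h with
  | x :: y :: l, _ =>
    obtain ⟨k, hk⟩ := hπ.2.2 x y ⟨[], l, by simp⟩
    simp at hk

/-- Induction on the edges in the order of introduction: parent paths consist of earlier edges. -/
theorem exists_premises (hG : IsCongruenceGraph E G) (c : Sym2 (GTerm L) → Color)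
    {es : List (Sym2 (GTerm L) × EdgeKind)} (hes : es <+: G.edges) {π : List (GTerm L)}
    (hπ : PathIn es π) : ∃ P, Premises G c π P ∧ ∀ τ ∈ P, PathIn es τ := by
  classical
  induction es using List.reverseRecOn generalizing π with
  | nil =>
    rcases path_cases c hπ.2.1 with ⟨x, rfl⟩ | ⟨h, -⟩ | ⟨Q, hQ, h2⟩
    · exact ⟨∅, .empty x, by simp⟩
    · exact absurd h (not_two_le_length_of_pathIn_nil hπ)
    · obtain ⟨σ, hσ⟩ := Finset.card_pos.1 (by omega : 0 < Q.card)
      exact absurd ((hQ σ).1 hσ).1 (not_two_le_length_of_pathIn_nil (hπ.factor ((hQ σ).1 hσ)))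
  | append_singleton es e ih =>
    have ih' := fun σ hσ => ih ((List.prefix_append _ _).trans hes) (π := σ) hσ
    have hmono : ∀ σ, PathIn (es ++ [e]) σ → 2 ≤ σ.length → (∃ X, Mono c X σ) →
        ∃ P, Premises G c σ P ∧ ∀ τ ∈ P, PathIn (es ++ [e]) τ := by
      rintro σ hσ hne ⟨X, hX⟩
      cases X with
      | A =>
        obtain ⟨P, hP, h⟩ := exists_premises_of_mono_A hG hes ih' hσ hne hX
        exact ⟨P, hP, fun τ hτ => (h τ hτ).mono (List.subset_append_left _ _)⟩
      | B =>
        refine ⟨{σ}, .pathB σ hne hX, fun τ hτ => ?_⟩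
        rwa [Finset.mem_singleton.1 hτ]
    rcases path_cases c hπ.2.1 with ⟨x, rfl⟩ | ⟨hne, hX⟩ | ⟨Q, hQ, h2⟩
    · exact ⟨∅, .empty x, by simp⟩
    · exact hmono π hπ hne hX
    · have := fun σ (hσ : σ ∈ Q) =>
        hmono σ (hπ.factor ((hQ σ).1 hσ)) ((hQ σ).1 hσ).1 ((hQ σ).1 hσ).2.2.1
      choose! F hF using this
      refine ⟨_, .factors π Q F hQ h2 fun σ hσ => (hF σ hσ).1, fun τ hτ => ?_⟩
      obtain ⟨σ, hσ, hτσ⟩ := Finset.mem_biUnion.1 hτ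
      exact (hF σ hσ).2 τ hτσ

/-- The same induction applies here, since the premises of a path of color `A` consist of edges that
are earlier than its last one. -/
theorem exists_pathInterp (hG : IsCongruenceGraph E G) (c : Sym2 (GTerm L) → Color)
    {es : List (Sym2 (GTerm L) × EdgeKind)} (hes : es <+: G.edges) {π : List (GTerm L)}
    (hπ : PathIn es π) : ∃ φ, PathInterp G c π φ := by
  induction es using List.reverseRecOn generalizing π with
  | nil =>
    rcases path_cases c hπ.2.1 with ⟨x, rfl⟩ | ⟨h, -⟩ | ⟨Q, hQ, h2⟩
    · exact ⟨_, .empty x⟩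
    · exact absurd h (not_two_le_length_of_pathIn_nil hπ)
    · obtain ⟨σ, hσ⟩ := Finset.card_pos.1 (by omega : 0 < Q.card)
      exact absurd ((hQ σ).1 hσ).1 (not_two_le_length_of_pathIn_nil (hπ.factor ((hQ σ).1 hσ)))
  | append_singleton es e ih =>
    have hes' : es <+: G.edges := (List.prefix_append _ _).trans hes
    have hmono : ∀ σ, PathIn (es ++ [e]) σ → 2 ≤ σ.length → (∃ X, Mono c X σ) →
        ∃ φ, PathInterp G c σ φ := by
      rintro σ hσ hne ⟨X, hX⟩
      cases X with
      | A =>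
        obtain ⟨P, hP, h⟩ := exists_premises_of_mono_A hG hes
          (fun τ hτ => exists_premises hG c hes' hτ) hσ hne hX
        choose! F hF using fun τ hτ => ih hes' (h τ hτ)
        exact ⟨_, .pathA σ P F hne hX hP hF⟩
      | B =>
        have hQ : ∀ τ, τ ∈ (finite_parents hG.isAcyclic σ).toFinset ↔ IsParent G τ σ := by simp
        choose! F hF using fun τ (hτ : τ ∈ (finite_parents hG.isAcyclic σ).toFinset) =>
          ih hes' (((hQ τ).1 hτ).pathIn hG hes hσ)
        exact ⟨_, .pathB σ _ F hne hX hQ hF⟩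
    rcases path_cases c hπ.2.1 with ⟨x, rfl⟩ | ⟨hne, hX⟩ | ⟨Q, hQ, h2⟩
    · exact ⟨_, .empty x⟩
    · exact hmono π hπ hne hX
    · choose! F hF using fun σ (hσ : σ ∈ Q) =>
        hmono σ (hπ.factor ((hQ σ).1 hσ)) ((hQ σ).1 hσ).1 ((hQ σ).1 hσ).2.2.1
      exact ⟨_, .factors π Q F hQ h2 hF⟩

end Evaluation

/-! ### Soundness -/

section Soundness

variable {A B : Finset (Literal L)} {G : CGraph L} {c : Sym2 (GTerm L) → Color}
  {M : Type w} [L.Structure M]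

theorem IsParent.pathIn_edges {G : CGraph L} {σ π : List (GTerm L)} (h : IsParent G σ π) :
    PathIn G.edges σ := by
  obtain ⟨n, f, us, vs, i, -, -, h⟩ := h
  exact h.pathIn

/-- If the ends of each parent path of a path of color `X` are equal in a model of the literals of
color `X`, then so are the ends of the path. -/
theorem value_eq_of_mono {E : Set (Sym2 (GTerm L))} (hG : IsCongruenceGraph E G)
    (hc : IsColoring A B G c) {X : Color} (hM : M ⊨ theoryOf (litsOf A B X))
    {π : List (GTerm L)} (hπ : PathIn G.edges π) (hX : Mono c X π)
    (hpar : ∀ σ x y, IsParent G σ π → Ends σ x y → value M x = value M y)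
    {x y : GTerm L} (hxy : Ends π x y) : value M x = value M y := by
  refine eq_of_edges (value M) hxy fun a b hab => ?_
  obtain ⟨k, hk⟩ := hπ.2.2 a b hab
  rcases (hG.mem_and_justified hk).2.2 with ⟨rfl, -⟩ | ⟨rfl, n, f, us, vs, rfl, rfl, hr⟩
  · have := (hc _ _ hk).1 rfl
    rw [hX a b hab] at this
    exact value_eq_of_mem_eqns hM this
  · rw [value_func, value_func]
    congr 1
    funext i
    obtain ⟨σ, hσ⟩ := exists_isPathBetween (G := G) (hr i)
    exact hpar σ _ _ ⟨n, f, us, vs, i, hab, hk, hσ⟩ hσ.ends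

theorem Premises.pathIn {π : List (GTerm L)} {P : Finset (List (GTerm L))}
    (h : Premises G c π P) (hπ : PathIn G.edges π) : ∀ τ ∈ P, PathIn G.edges τ := by
  classical
  induction h with
  | empty x => simp
  | factors π Q F hQ h2 hF ih =>
    intro τ hτ
    obtain ⟨σ, hσ, hτσ⟩ := Finset.mem_biUnion.1 hτ
    exact ih σ hσ (hπ.factor ((hQ σ).1 hσ)) τ hτσ
  | pathB π hne hB =>
    intro τ hτ
    rwa [Finset.mem_singleton.1 hτ]
  | pathA π Q F hne hA hQ hF ih =>
    intro τ hτ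
    obtain ⟨σ, hσ, hτσ⟩ := Finset.mem_biUnion.1 hτ
    exact ih σ hσ ((hQ σ).1 hσ).pathIn_edges τ hτσ

/-- The `B`-premises of a path, together with the literals in `A`, entail the equality of its
ends. -/
theorem Premises.value_eq {E : Set (Sym2 (GTerm L))} (hG : IsCongruenceGraph E G)
    (hc : IsColoring A B G c) (hM : M ⊨ theoryOf A) {π : List (GTerm L)}
    {P : Finset (List (GTerm L))} (h : Premises G c π P) (hπ : PathIn G.edges π)
    (hP : ∀ τ ∈ P, M ⊨ summary τ) {x y : GTerm L} (hxy : Ends π x y) :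
    value M x = value M y := by
  classical
  induction h generalizing x y with
  | empty z =>
    obtain ⟨h₁, h₂⟩ := hxy
    simp only [List.head?_cons, List.getLast?_singleton, Option.some.injEq] at h₁ h₂
    rw [← h₁, ← h₂]
  | factors π Q F hQ h2 hF ih =>
    refine eq_of_factors (value M) (c := c) hπ.1 hxy fun σ a b hσ hab => ?_
    have hσQ := (hQ σ).2 hσ
    exact ih σ hσQ (hπ.factor hσ)
      (fun τ hτ => hP τ (Finset.mem_biUnion.2 ⟨σ, hσQ, hτ⟩)) hab
  | pathB π hne hB => exact (realize_summary_iff hxy).1 (hP π (Finset.mem_singleton_self π))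
  | pathA π Q F hne hA hQ hF ih =>
    refine value_eq_of_mono (X := .A) hG hc hM hπ hA (fun σ a b hσ hab => ?_) hxy
    have hσQ := (hQ σ).2 hσ
    exact ih σ hσQ hσ.pathIn_edges
      (fun τ hτ => hP τ (Finset.mem_biUnion.2 ⟨σ, hσQ, hτ⟩)) hab

theorem PathInterp.realize {E : Set (Sym2 (GTerm L))} (hG : IsCongruenceGraph E G)
    (hc : IsColoring A B G c) (hM : M ⊨ theoryOf A) {π : List (GTerm L)} {φ : L.Sentence}
    (h : PathInterp G c π φ) (hπ : PathIn G.edges π) : M ⊨ φ := by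
  induction h with
  | empty x => exact realize_top
  | factors π Q F hQ h2 hF ih =>
    exact (realize_conj_iff _ _).2 fun σ hσ => ih σ hσ (hπ.factor ((hQ σ).1 hσ))
  | pathB π Q F hne hB hQ hF ih =>
    exact (realize_conj_iff _ _).2 fun σ hσ => ih σ hσ ((hQ σ).1 hσ).pathIn_edges
  | pathA π P F hne hA hP hF ih =>
    refine (realize_inf_iff _ _).2 ⟨?_, (realize_conj_iff _ _).2 fun σ hσ =>
      ih σ hσ (hP.pathIn hπ σ hσ)⟩
    obtain ⟨x, y, hxy⟩ := exists_ends hπ.2.1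
    rw [justification, realize_imp_iff, realize_conj_iff, realize_summary_iff hxy]
    exact fun h => hP.value_eq hG hc hM hπ h hxy

/-- The path interpolant, together with the literals in `B`, entails the equality of the ends of
the path. -/
theorem PathInterp.value_eq {E : Set (Sym2 (GTerm L))} (hG : IsCongruenceGraph E G)
    (hc : IsColoring A B G c) (hM : M ⊨ theoryOf B) {π : List (GTerm L)} {φ : L.Sentence}
    (h : PathInterp G c π φ) (hπ : PathIn G.edges π) (hφ : M ⊨ φ) {x y : GTerm L}
    (hxy : Ends π x y) : value M x = value M y := by
  induction h generalizing x y with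
  | empty z =>
    obtain ⟨h₁, h₂⟩ := hxy
    simp only [List.head?_cons, List.getLast?_singleton, Option.some.injEq] at h₁ h₂
    rw [← h₁, ← h₂]
  | factors π Q F hQ h2 hF ih =>
    refine eq_of_factors (value M) (c := c) hπ.1 hxy fun σ a b hσ hab => ?_
    have hσQ := (hQ σ).2 hσ
    exact ih σ hσQ (hπ.factor hσ) ((realize_conj_iff _ _).1 hφ σ hσQ) hab
  | pathB π Q F hne hB hQ hF ih =>
    refine value_eq_of_mono (X := .B) hG hc hM hπ hB (fun σ a b hσ hab => ?_) hxy
    have hσQ := (hQ σ).2 hσ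
    exact ih σ hσQ hσ.pathIn_edges ((realize_conj_iff _ _).1 hφ σ hσQ) hab
  | pathA π P F hne hA hP hF ih =>
    rw [realize_inf_iff, justification, realize_imp_iff, realize_conj_iff, realize_conj_iff,
      realize_summary_iff hxy] at hφ
    refine hφ.1 fun σ hσ => ?_
    have hσπ := hP.pathIn hπ σ hσ
    obtain ⟨a, b, hab⟩ := exists_ends hσπ.2.1
    exact (realize_summary_iff hab).2 (ih σ hσ hσπ (hφ.2 σ hσ) hab)

end Soundness

/-! ### The symbols of path interpolants, and their Horn form -/

section Symbols

variable {A B : Finset (Literal L)} {G : CGraph L} {c : Sym2 (GTerm L) → Color}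

theorem IsColoring.colorable_edge (hc : IsColoring A B G c) {π : List (GTerm L)}
    (hπ : PathIn G.edges π) {X : Color} {x y : GTerm L} (hxy : [x, y] <:+: π)
    (hX : c s(x, y) = X) : Colorable (litsOf A B X) x ∧ Colorable (litsOf A B X) y := by
  obtain ⟨k, hk⟩ := hπ.2.2 x y hxy
  subst hX
  exact ⟨(hc _ _ hk).2 x (Sym2.mem_mk_left x y), (hc _ _ hk).2 y (Sym2.mem_mk_right x y)⟩

theorem IsFactor.colorable_ends {X : Color} (hc : IsColoring A B G c) {π σ : List (GTerm L)}
    (hπ : PathIn G.edges π) (hσ : IsFactor c σ π) {x y a b : GTerm L} (hxy : Ends π x y)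
    (hab : Ends σ a b) (hx : Colorable (litsOf A B X) x) (hy : Colorable (litsOf A B X) y) :
    Colorable (litsOf A B X) a ∧ Colorable (litsOf A B X) b :=
  hσ.ends_prop hxy hab hx hy fun _ _ huv h => hc.colorable_edge hπ huv h

theorem Mono.colorable_ends {X : Color} (hc : IsColoring A B G c) {π : List (GTerm L)}
    (hπ : PathIn G.edges π) (hne : 2 ≤ π.length) (hX : Mono c X π) {x y : GTerm L}
    (hxy : Ends π x y) : Colorable (litsOf A B X) x ∧ Colorable (litsOf A B X) y := by
  have hhead : ∀ {ρ : List (GTerm L)} {a b : GTerm L}, 2 ≤ ρ.length → Ends ρ a b →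
      ∃ z, [a, z] <:+: ρ := by
    intro ρ a b h2 hab
    match ρ, h2 with
    | a' :: z :: l, _ =>
      obtain rfl : a' = a := by simpa using hab.1
      exact ⟨z, [], l, by simp⟩
  obtain ⟨z, hz⟩ := hhead hne hxy
  obtain ⟨z', hz'⟩ := hhead (by simpa using hne) (ends_reverse hxy)
  rw [pair_infix_reverse] at hz'
  exact ⟨(hc.colorable_edge hπ hz (hX _ _ hz)).1, (hc.colorable_edge hπ hz' (hX _ _ hz')).2⟩

theorem IsParent.colorable_ends {X : Color} (hc : IsColoring A B G c) {π σ : List (GTerm L)}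
    (hπ : PathIn G.edges π) (hX : Mono c X π) (hσ : IsParent G σ π) {a b : GTerm L}
    (hab : Ends σ a b) : Colorable (litsOf A B X) a ∧ Colorable (litsOf A B X) b := by
  obtain ⟨n, f, us, vs, i, hi, -, h⟩ := hσ
  obtain ⟨h₁, h₂⟩ := hc.colorable_edge hπ hi (hX _ _ hi)
  obtain rfl : us i = a := Option.some.inj (h.ends.1.symm.trans hab.1)
  obtain rfl : vs i = b := Option.some.inj (h.ends.2.symm.trans hab.2)
  exact ⟨(colorable_func_iff.1 h₁).2 i, (colorable_func_iff.1 h₂).2 i⟩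

/-- The `B`-premises of a path with `A`-colorable ends have `AB`-colorable ends. -/
theorem Premises.colorable_ends (hc : IsColoring A B G c) {π : List (GTerm L)}
    {P : Finset (List (GTerm L))} (h : Premises G c π P) (hπ : PathIn G.edges π) {x y : GTerm L}
    (hxy : Ends π x y) (hx : Colorable A x) (hy : Colorable A y) :
    ∀ τ ∈ P, ∀ a b, Ends τ a b →
      (Colorable A a ∧ Colorable B a) ∧ (Colorable A b ∧ Colorable B b) := by
  classical
  induction h generalizing x y with
  | empty z => simp
  | factors π Q F hQ h2 hF ih =>
    intro τ hτ
    obtain ⟨σ, hσ, hτσ⟩ := Finset.mem_biUnion.1 hτ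
    have hσπ := (hQ σ).1 hσ
    obtain ⟨a, b, hab⟩ := exists_ends (hπ.factor hσπ).2.1
    obtain ⟨ha, hb⟩ := hσπ.colorable_ends (X := .A) hc hπ hxy hab hx hy
    exact ih σ hσ (hπ.factor hσπ) hab ha hb τ hτσ
  | pathB π hne hB =>
    intro τ hτ a b hab
    obtain rfl := Finset.mem_singleton.1 hτ
    obtain rfl : x = a := Option.some.inj (hxy.1.symm.trans hab.1)
    obtain rfl : y = b := Option.some.inj (hxy.2.symm.trans hab.2)
    have := Mono.colorable_ends hc hπ hne hB hab
    exact ⟨⟨hx, this.1⟩, ⟨hy, this.2⟩⟩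
  | pathA π Q F hne hA hQ hF ih =>
    intro τ hτ
    obtain ⟨σ, hσ, hτσ⟩ := Finset.mem_biUnion.1 hτ
    have hσπ := (hQ σ).1 hσ
    obtain ⟨a, b, hab⟩ := exists_ends hσπ.pathIn_edges.2.1
    obtain ⟨ha, hb⟩ := hσπ.colorable_ends hc hπ hA hab
    exact ih σ hσ hσπ.pathIn_edges hab ha hb τ hτσ

theorem summary_symbols_subset_of_colorable {τ : List (GTerm L)} (hτ : τ ≠ [])
    (h : ∀ a b, Ends τ a b →
      (Colorable A a ∧ Colorable B a) ∧ (Colorable A b ∧ Colorable B b)) :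
    formulaSymbols (summary τ) ⊆ symbolsOf A ∩ symbolsOf B := by
  obtain ⟨a, b, hab⟩ := exists_ends hτ
  obtain ⟨⟨h₁, h₂⟩, h₃, h₄⟩ := h a b hab
  exact formulaSymbols_summary_subset hab (Set.subset_inter h₁ h₂) (Set.subset_inter h₃ h₄)

/-- The interpolant of a path with `B`-colorable ends contains shared symbols only. Empty paths
need no condition on their vertex. -/
theorem PathInterp.symbols_subset (hc : IsColoring A B G c) {π : List (GTerm L)}
    {φ : L.Sentence} (h : PathInterp G c π φ) (hπ : PathIn G.edges π) {x y : GTerm L}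
    (hxy : Ends π x y) (hB : 2 ≤ π.length → Colorable B x ∧ Colorable B y) :
    formulaSymbols φ ⊆ symbolsOf A ∩ symbolsOf B := by
  induction h generalizing x y with
  | empty z => rw [formulaSymbols_top]; exact Set.empty_subset _
  | factors π Q F hQ h2 hF ih =>
    refine formulaSymbols_conj_subset fun σ hσ => ?_
    have hσπ := (hQ σ).1 hσ
    obtain ⟨a, b, hab⟩ := exists_ends (hπ.factor hσπ).2.1
    obtain ⟨hx, hy⟩ := hB (hσπ.1.trans hσπ.2.1.length_le)
    exact ih σ hσ (hπ.factor hσπ) hab fun _ =>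
      hσπ.colorable_ends (X := .B) hc hπ hxy hab hx hy
  | pathB π Q F hne hB' hQ hF ih =>
    refine formulaSymbols_conj_subset fun σ hσ => ?_
    have hσπ := (hQ σ).1 hσ
    obtain ⟨a, b, hab⟩ := exists_ends hσπ.pathIn_edges.2.1
    exact ih σ hσ hσπ.pathIn_edges hab fun _ => hσπ.colorable_ends hc hπ hB' hab
  | pathA π P F hne hA hP hF ih =>
    obtain ⟨hxA, hyA⟩ := Mono.colorable_ends (X := .A) hc hπ hne hA hxy
    obtain ⟨hxB, hyB⟩ := hB hne
    have hcol := hP.colorable_ends hc hπ hxy hxA hyA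
    rw [formulaSymbols_inf, justification, formulaSymbols_imp]
    refine Set.union_subset (Set.union_subset ?_ ?_) ?_
    · exact formulaSymbols_conj_subset fun τ hτ =>
        summary_symbols_subset_of_colorable (hP.pathIn hπ τ hτ).2.1 (hcol τ hτ)
    · exact formulaSymbols_summary_subset hxy (Set.subset_inter hxA hxB)
        (Set.subset_inter hyA hyB)
    · refine formulaSymbols_conj_subset fun τ hτ => ?_
      have hτπ := hP.pathIn hπ τ hτ
      obtain ⟨a, b, hab⟩ := exists_ends hτπ.2.1
      have := hcol τ hτ a b hab
      exact ih τ hτ hτπ hab fun _ => ⟨this.1.2, this.2.2⟩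

theorem PathInterp.isHornConj {π : List (GTerm L)} {φ : L.Sentence} (h : PathInterp G c π φ) :
    IsHornConj φ := by
  induction h with
  | empty x => exact .top
  | factors π Q F hQ h2 hF ih => exact isHornConj_conj ih
  | pathB π Q F hne hB hQ hF ih => exact isHornConj_conj ih
  | pathA π P F hne hA hP hF ih => exact .and (isHornConj_justification P hne) (isHornConj_conj ih)

end Symbols

/-! ### Decomposition of paths for disequalities of the first set -/

theorem exists_first {α : Type w} {p : α → Prop} {l : List α} (h : ∃ x ∈ l, p x) :
    ∃ a x b, l = a ++ x :: b ∧ p x ∧ ∀ z ∈ a, ¬ p z := by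
  induction l with
  | nil => simp at h
  | cons y l ih =>
    by_cases hy : p y
    · exact ⟨[], y, l, rfl, hy, by simp⟩
    · obtain ⟨x, hx, hpx⟩ := h
      have hxl : x ∈ l := by
        rcases List.mem_cons.1 hx with rfl | h
        · exact absurd hpx hy
        · exact h
      obtain ⟨a, z, b, rfl, hz, ha⟩ := ih ⟨x, hxl, hpx⟩
      exact ⟨y :: a, z, b, rfl, hz, by simpa using ⟨hy, ha⟩⟩

/-- A part of `a ++ θ ++ b` whose first and last elements satisfy `p` lies in `θ`, if no element of
`a` or `b` satisfies `p`. -/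
theorem infix_of_not_mem {α : Type w} {p : α → Prop} {a θ b τ : List α}
    (ha : ∀ z ∈ a, ¬ p z) (hb : ∀ z ∈ b, ¬ p z) (hτ : τ <:+: a ++ θ ++ b)
    (h₁ : ∀ x ∈ τ.head?, p x) (h₂ : ∀ x ∈ τ.getLast?, p x) : τ <:+: θ := by
  -- A list whose first element satisfies `p` cannot start inside `a`.
  have cut : ∀ {a θ τ : List α}, (∀ z ∈ a, ¬ p z) → τ <:+: a ++ θ → (∀ x ∈ τ.head?, p x) →
      τ <:+: θ := by
    intro a θ τ ha hτ h
    induction a with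
    | nil => exact hτ
    | cons y a ih =>
      refine ih (fun z hz => ha z (List.mem_cons_of_mem _ hz)) ?_
      rw [List.cons_append] at hτ
      rcases List.infix_cons_iff.1 hτ with hp | hi
      · rcases τ with _ | ⟨t, τ⟩
        · exact List.nil_infix
        · rw [List.cons_prefix_cons] at hp
          exact absurd (h t rfl) (hp.1 ▸ ha y List.mem_cons_self)
      · exact hi
  rw [List.append_assoc] at hτ
  have hτ' := cut ha hτ h₁
  rw [← List.reverse_infix, List.reverse_append] at hτ'
  rw [← List.reverse_infix]
  exact cut (by simpa using hb) hτ' (by simpa using h₂)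

/-- The middle part extends from the first to the last `B`-colorable vertex. -/
theorem exists_isSplit (B : Finset (Literal L)) {π : List (GTerm L)} (hπ : π ≠ []) :
    ∃ π₁ θ π₂, IsSplit B π π₁ θ π₂ := by
  by_cases h : ∃ x ∈ π, Colorable B x
  · obtain ⟨l, x, b, rfl, hx, hl⟩ := exists_first h
    obtain ⟨r, y, t, hr, hy, hr'⟩ :=
      exists_first (p := Colorable B) (l := (x :: b).reverse) ⟨x, by simp, hx⟩
    have hxb : x :: b = (t.reverse ++ [y]) ++ r.reverse := by
      have := congrArg List.reverse hr
      simpa using this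
    have hhead : (t.reverse ++ [y]).head? = some x := by
      rcases ht : t.reverse with _ | ⟨z, t'⟩
      · rw [ht] at hxb
        simp only [List.nil_append, List.cons_append, List.cons.injEq] at hxb
        simp [hxb.1]
      · rw [ht] at hxb
        simp only [List.cons_append, List.cons.injEq] at hxb
        simp [hxb.1]
    refine ⟨l ++ [x], t.reverse ++ [y], y :: r.reverse,
      ⟨l, r.reverse, x, y, by rw [hxb]; simp, hhead, by simp, rfl, rfl⟩, fun _ => ⟨?_, ?_, ?_⟩,
      fun hno => absurd hx (hno x (by simp))⟩
    · rw [hhead]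
      rintro z hz
      obtain rfl := Option.some.inj hz
      exact hx
    · rw [List.getLast?_concat]
      rintro z hz
      obtain rfl := Option.some.inj hz
      exact hy
    · intro τ hτ h₁ h₂
      refine infix_of_not_mem hl (b := r.reverse) (by simpa using hr') ?_ h₁ h₂
      rwa [List.append_assoc, ← hxb]
  · match π, hπ with
    | x :: l, _ =>
      exact ⟨[x], [x], x :: l, ⟨[], l, x, x, rfl, rfl, rfl, rfl, rfl⟩, fun h' => absurd h' h,
        fun _ => rfl⟩

theorem IsSplit.pathIn {B : Finset (Literal L)} {es : List (Sym2 (GTerm L) × EdgeKind)}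
    {π π₁ θ π₂ : List (GTerm L)} (h : IsSplit B π π₁ θ π₂) (hπ : PathIn es π) :
    PathIn es π₁ ∧ PathIn es θ ∧ PathIn es π₂ := by
  obtain ⟨⟨l, r, x, y, hlr, hx, hy, hl, hr⟩, -, -⟩ := h
  refine ⟨hπ.of_infix ?_ (by simp [hl]), hπ.of_infix ⟨l, r, hlr.symm⟩ (by rintro rfl; simp at hx),
    hπ.of_infix ?_ (by simp [hr])⟩
  · rcases θ with _ | ⟨a, θ⟩
    · simp at hx
    · obtain rfl : a = x := by simpa using hx
      exact ⟨[], θ ++ r, by simp [hl, hlr]⟩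
  · rcases List.eq_nil_or_concat θ with rfl | ⟨θ, a, rfl⟩
    · simp at hx
    · obtain rfl : a = y := by simpa using hy
      exact ⟨l ++ θ, [], by simp [hr, hlr]⟩

/-- If the whole path starts with an `A`-colorable vertex, then so does its middle part: the vertex
before it, if there is one, is not `B`-colorable. -/
theorem colorable_of_split {A B : Finset (Literal L)} {G : CGraph L}
    {c : Sym2 (GTerm L) → Color} (hc : IsColoring A B G c) {π l θ r : List (GTerm L)}
    (hπ : PathIn G.edges π) (hlr : π = l ++ θ ++ r) {s t x y : GTerm L} (hst : Ends π s t)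
    (hxy : Ends θ x y) (hy : ∀ z ∈ π, Colorable B z → Colorable B y)
    (hmax : ∀ τ, τ <:+: π → (∀ x ∈ τ.head?, Colorable B x) → (∀ x ∈ τ.getLast?, Colorable B x) →
      τ.length ≤ θ.length) (hs : Colorable A s) : Colorable A x := by
  obtain ⟨θ', rfl⟩ : ∃ θ', θ = x :: θ' := by
    have := hxy.1
    rcases θ with _ | ⟨a, θ'⟩
    · simp at this
    · exact ⟨θ', by simpa using this⟩
  rcases List.eq_nil_or_concat l with rfl | ⟨l, z, rfl⟩
  · have := hst.1
    rw [hlr] at this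
    obtain rfl : x = s := by simpa using this
    exact hs
  · have hzx : [z, x] <:+: π := ⟨l, θ' ++ r, by simp [hlr]⟩
    have hz : ¬ Colorable B z := by
      intro hz
      have := hmax (z :: x :: θ') ⟨l, r, by simp [hlr]⟩ (by simpa using hz) ?_
      · simp at this
      · rw [List.getLast?_cons_cons, hxy.2]
        intro y' hy'
        obtain rfl := Option.some.inj hy'
        exact hy z (by simp [hlr]) hz
    have hA : c s(z, x) = .A := by
      cases hX : c s(z, x) with
      | A => rfl
      | B => exact absurd (hc.colorable_edge hπ hzx hX).1 hz
    exact (hc.colorable_edge hπ hzx hA).2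

/-- In a decomposition of a path with `A`-colorable ends, the middle part has `A`-colorable ends.
If it is nonempty, they are also `B`-colorable. -/
theorem IsSplit.colorable_ends {A B : Finset (Literal L)} {G : CGraph L}
    {c : Sym2 (GTerm L) → Color} (hc : IsColoring A B G c) {π π₁ θ π₂ : List (GTerm L)}
    (hπ : PathIn G.edges π) (h : IsSplit B π π₁ θ π₂) {s t x y : GTerm L} (hst : Ends π s t)
    (hxy : Ends θ x y) (hs : Colorable A s) (ht : Colorable A t) :
    (Colorable A x ∧ Colorable A y) ∧ (2 ≤ θ.length → Colorable B x ∧ Colorable B y) := by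
  obtain ⟨⟨l, r, x', y', hlr, hx', hy', -, -⟩, hcol, hno⟩ := h
  have hB : ∀ z ∈ π, Colorable B z → Colorable B x ∧ Colorable B y := fun z hz hBz =>
    ⟨(hcol ⟨z, hz, hBz⟩).1 x hxy.1, (hcol ⟨z, hz, hBz⟩).2.1 y hxy.2⟩
  have hmax : ∀ τ, τ <:+: π → (∀ x ∈ τ.head?, Colorable B x) →
      (∀ x ∈ τ.getLast?, Colorable B x) → τ.length ≤ θ.length := by
    intro τ hτ h₁ h₂
    rcases τ with _ | ⟨a, τ⟩
    · simp
    · exact ((hcol ⟨a, hτ.subset List.mem_cons_self, h₁ a rfl⟩).2.2 _ hτ h₁ h₂).length_le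
  have hπr : PathIn G.edges π.reverse := by
    refine ⟨List.nodup_reverse.2 hπ.1, by simpa using hπ.2.1, fun a b hab => ?_⟩
    rw [Sym2.eq_swap]
    exact hπ.2.2 b a (pair_infix_reverse.1 hab)
  refine ⟨⟨colorable_of_split hc hπ hlr hst hxy (fun z hz hBz => (hB z hz hBz).2) hmax hs, ?_⟩,
    fun h2 => ?_⟩
  · refine colorable_of_split hc hπr (l := r.reverse) (θ := θ.reverse) (r := l.reverse)
      (by simp [hlr]) (ends_reverse hst) (ends_reverse hxy)
      (fun z hz hBz => (hB z (by simpa using hz) hBz).1) ?_ ht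
    intro τ hτ h₁ h₂
    rw [← List.reverse_infix, List.reverse_reverse] at hτ
    simpa using hmax τ.reverse hτ (by simpa using h₂) (by simpa using h₁)
  · by_cases hex : ∃ z ∈ π, Colorable B z
    · obtain ⟨z, hz, hBz⟩ := hex
      exact hB z hz hBz
    · have := hno fun z hz hBz => hex ⟨z, hz, hBz⟩
      omega

/-! ### Interpolants from colored congruence graphs -/

theorem isInterpolant_of {A B : Finset (Literal L)} {φ : L.Sentence} (hhorn : IsHornConj φ)
    (hsym : formulaSymbols φ ⊆ symbolsOf A ∩ symbolsOf B)
    (hA : ∀ (M : Type (max u v)) [L.Structure M], M ⊨ theoryOf A → M ⊨ φ)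
    (hB : ∀ (M : Type (max u v)) [L.Structure M], M ⊨ theoryOf B → ¬ M ⊨ φ) :
    IsInterpolant A B φ := by
  refine ⟨hhorn.isQF, hsym, ?_, ?_⟩
  · rw [Theory.models_sentence_iff]
    exact fun M => hA M M.is_model
  · rintro ⟨M⟩
    have h := M.is_model
    rw [Theory.model_union_iff] at h
    exact hB M h.1 (Theory.model_singleton_iff.1 h.2)

/-- For a disequality `s ≠ t` in `B`, the path interpolant entails `s = t` together with `B`. For one
in `A`, the literals in `A` and the premises of the outer parts equate `s` and `t` with the ends of
the middle part, so that these ends differ, whereas the interpolant of the middle part equates them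
together with `B`. -/
theorem Returns.isInterpolant {A B : Finset (Literal L)} {E : Set (Sym2 (GTerm L))}
    {G : CGraph L} (hG : IsCongruenceGraph E G) {c : Sym2 (GTerm L) → Color}
    (hc : IsColoring A B G c) {s t : GTerm L} {X : Color} (hst : Literal.ne s t ∈ litsOf A B X)
    {φ : L.Sentence} (h : Returns B G c s t X φ) : IsInterpolant A B φ ∧ IsHornConj φ := by
  obtain ⟨π, hst', h⟩ := h
  have hπ := hst'.pathIn
  have hends := hst'.ends
  have hs : Colorable (litsOf A B X) s := colorable_of_mem_literal hst (by simp [Literal.sides])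
  have ht : Colorable (litsOf A B X) t := colorable_of_mem_literal hst (by simp [Literal.sides])
  rcases h with ⟨rfl, h⟩ | ⟨rfl, h⟩
  · refine ⟨isInterpolant_of h.isHornConj (h.symbols_subset hc hπ hends fun _ => ⟨hs, ht⟩)
      (fun M _ hM => h.realize hG hc hM hπ) fun M _ hM hφ => ?_, h.isHornConj⟩
    exact ((model_theoryOf_iff B).1 hM).2 s t hst (h.value_eq hG hc hM hπ hφ hends)
  · obtain ⟨π₁, θ, π₂, P₁, P₂, φ, F, hsplit, h₁, h₂, hφ, hF⟩ := h
    obtain ⟨⟨l, r, x, y, hlr, hx, hy, hl, hr⟩, -, hno⟩ := id hsplit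
    have hxy : Ends θ x y := ⟨hx, hy⟩
    obtain ⟨⟨hxA, hyA⟩, hxyB⟩ := hsplit.colorable_ends hc hπ hends hxy hs ht
    obtain ⟨hπ₁, hθ, hπ₂⟩ := hsplit.pathIn hπ
    have he₁ : Ends π₁ s x := by
      refine ⟨?_, by simp [hl]⟩
      have := hends.1
      rw [hlr, List.append_assoc, List.head?_append, List.head?_append, hx] at this
      rw [hl, List.head?_append, List.head?_cons]
      simpa using this
    have he₂ : Ends π₂ y t := by
      refine ⟨by simp [hr], ?_⟩
      have := hends.2
      rw [hlr, List.getLast?_append, List.getLast?_append, hy] at this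
      rw [hr, List.getLast?_cons, ← this]
      cases r.getLast? <;> simp
    classical
    have hPin : ∀ τ ∈ P₁ ∪ P₂, PathIn G.edges τ := fun τ hτ =>
      (Finset.mem_union.1 hτ).elim (h₁.pathIn hπ₁ τ) (h₂.pathIn hπ₂ τ)
    have hPcol : ∀ τ ∈ P₁ ∪ P₂, ∀ a b, Ends τ a b →
        (Colorable A a ∧ Colorable B a) ∧ (Colorable A b ∧ Colorable B b) := fun τ hτ =>
      (Finset.mem_union.1 hτ).elim (h₁.colorable_ends hc hπ₁ he₁ hs hxA τ)
        (h₂.colorable_ends hc hπ₂ he₂ hyA ht τ)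
    have hhorn : IsHornConj
        (φ ⊓ conj (P₁ ∪ P₂) F ⊓ (conj (P₁ ∪ P₂) summary ⟹ ∼(summary θ))) :=
      .and (.and hφ.isHornConj (isHornConj_conj fun τ hτ => (hF τ hτ).isHornConj))
        (.clause (.imp (isEqConj_conj_summary _) (.imp (isEqConj_summary θ) .bot)))
    refine ⟨isInterpolant_of hhorn ?_ (fun M _ hM => ?_) (fun M _ hM hI => ?_), hhorn⟩
    · rw [formulaSymbols_inf, formulaSymbols_inf, formulaSymbols_imp, formulaSymbols_not]
      refine Set.union_subset (Set.union_subset (hφ.symbols_subset hc hθ hxy hxyB) ?_)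
        (Set.union_subset ?_ ?_)
      · refine formulaSymbols_conj_subset fun τ hτ => ?_
        obtain ⟨a, b, hab⟩ := exists_ends (hPin τ hτ).2.1
        have := hPcol τ hτ a b hab
        exact (hF τ hτ).symbols_subset hc (hPin τ hτ) hab fun _ => ⟨this.1.2, this.2.2⟩
      · exact formulaSymbols_conj_subset fun τ hτ =>
          summary_symbols_subset_of_colorable (hPin τ hτ).2.1 (hPcol τ hτ)
      · by_cases h2 : 2 ≤ θ.length
        · exact formulaSymbols_summary_subset hxy (Set.subset_inter hxA (hxyB h2).1)
            (Set.subset_inter hyA (hxyB h2).2)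
        · rcases θ with _ | ⟨a, _ | ⟨b, θ⟩⟩
          · exact absurd rfl hθ.2.1
          · exact formulaSymbols_top.trans_subset (Set.empty_subset _)
          · exact absurd (by simp) h2
    · rw [realize_inf_iff, realize_inf_iff, realize_imp_iff, realize_not_iff, realize_conj_iff,
        realize_conj_iff, realize_summary_iff hxy]
      refine ⟨⟨hφ.realize hG hc hM hθ, fun τ hτ => (hF τ hτ).realize hG hc hM (hPin τ hτ)⟩,
        fun hP hval => ((model_theoryOf_iff A).1 hM).2 s t hst ?_⟩
      have e₁ := h₁.value_eq hG hc hM hπ₁ (fun τ hτ => hP τ (Finset.mem_union_left _ hτ)) he₁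
      have e₂ := h₂.value_eq hG hc hM hπ₂ (fun τ hτ => hP τ (Finset.mem_union_right _ hτ)) he₂
      exact e₁.trans (hval.trans e₂)
    · rw [realize_inf_iff, realize_inf_iff, realize_imp_iff, realize_not_iff, realize_conj_iff,
        realize_conj_iff, realize_summary_iff hxy] at hI
      obtain ⟨⟨hI₁, hI₂⟩, hI₃⟩ := hI
      refine hI₃ (fun τ hτ => ?_) (hφ.value_eq hG hc hM hθ hI₁ hxy)
      obtain ⟨a, b, hab⟩ := exists_ends (hPin τ hτ).2.1
      exact (realize_summary_iff hab).2 ((hF τ hτ).value_eq hG hc hM (hPin τ hτ) (hI₂ τ hτ) hab)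

theorem exists_returns {B : Finset (Literal L)} {E : Set (Sym2 (GTerm L))} {G : CGraph L}
    (hG : IsCongruenceGraph E G) (c : Sym2 (GTerm L) → Color) {s t : GTerm L}
    (hst : G.graph.Reachable s t) (X : Color) : ∃ φ, Returns B G c s t X φ := by
  classical
  obtain ⟨π, hπst⟩ := exists_isPathBetween hst
  have hπ := hπst.pathIn
  cases X with
  | B =>
    obtain ⟨φ, hφ⟩ := exists_pathInterp hG c List.prefix_rfl hπ
    exact ⟨φ, π, hπst, .inl ⟨rfl, hφ⟩⟩
  | A =>
    obtain ⟨π₁, θ, π₂, hsplit⟩ := exists_isSplit B hπ.2.1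
    obtain ⟨hπ₁, hθ, hπ₂⟩ := hsplit.pathIn hπ
    obtain ⟨P₁, h₁, hP₁⟩ := exists_premises hG c List.prefix_rfl hπ₁
    obtain ⟨P₂, h₂, hP₂⟩ := exists_premises hG c List.prefix_rfl hπ₂
    obtain ⟨φ, hφ⟩ := exists_pathInterp hG c List.prefix_rfl hθ
    have hF : ∀ τ ∈ P₁ ∪ P₂, ∃ ψ, PathInterp G c τ ψ := fun τ hτ =>
      exists_pathInterp hG c List.prefix_rfl
        ((Finset.mem_union.1 hτ).elim (hP₁ τ) (hP₂ τ))
    choose! F hF using hF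
    exact ⟨_, π, hπst, .inr ⟨rfl, .mk π π₁ θ π₂ P₁ P₂ φ F hsplit h₁ h₂ hφ hF⟩⟩

/-! ### Subterms -/

theorem mem_subterms_func {n : ℕ} {f : L.Functions n} {ts : Fin n → GTerm L} {s : GTerm L} :
    s ∈ subterms (Term.func f ts) ↔ s = Term.func f ts ∨ ∃ i, s ∈ subterms (ts i) := by
  simp [subterms]

theorem self_mem_subterms (t : GTerm L) : t ∈ subterms t := by
  cases t with
  | var x => exact x.elim
  | func f ts => exact mem_subterms_func.2 (.inl rfl)

theorem subterms_subset_of_mem {s t : GTerm L} (h : s ∈ subterms t) :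
    subterms s ⊆ subterms t := by
  induction t with
  | var x => exact x.elim
  | func f ts ih =>
    rcases mem_subterms_func.1 h with rfl | ⟨i, hi⟩
    · exact Finset.Subset.refl _
    · exact fun r hr => mem_subterms_func.2 (.inr ⟨i, ih i hi hr⟩)

theorem Colorable.of_mem_subterms {S : Finset (Literal L)} {s t : GTerm L} (ht : Colorable S t)
    (h : s ∈ subterms t) : Colorable S s := by
  induction t with
  | var x => exact x.elim
  | func f ts ih =>
    rcases mem_subterms_func.1 h with rfl | ⟨i, hi⟩
    · exact ht
    · exact ih i ((colorable_func_iff.1 ht).2 i) hi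

theorem mem_termsOf {S : Finset (Literal L)} {t : GTerm L} :
    t ∈ termsOf S ↔ ∃ l ∈ S, ∃ s ∈ l.sides, t ∈ subterms s := by
  simp [termsOf]

theorem mem_termsOf_of_mem_sides {S : Finset (Literal L)} {l : Literal L} (hl : l ∈ S)
    {t : GTerm L} (ht : t ∈ l.sides) : t ∈ termsOf S :=
  mem_termsOf.2 ⟨l, hl, t, ht, self_mem_subterms t⟩

theorem subtermClosed_termsOf (S : Finset (Literal L)) : SubtermClosed (termsOf S) := by
  intro t ht r hr
  obtain ⟨l, hl, s, hs, hts⟩ := mem_termsOf.1 ht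
  exact mem_termsOf.2 ⟨l, hl, s, hs, subterms_subset_of_mem hts hr⟩

theorem SubtermClosed.args_mem {T : Finset (GTerm L)} (hT : SubtermClosed T) {n : ℕ}
    {f : L.Functions n} {ts : Fin n → GTerm L} (h : Term.func f ts ∈ T) (i : Fin n) :
    ts i ∈ T :=
  hT _ h (mem_subterms_func.2 (.inr ⟨i, self_mem_subterms _⟩))

open Classical in
theorem mem_union_iff_exists_litsOf {A B : Finset (Literal L)} {l : Literal L} :
    l ∈ A ∪ B ↔ ∃ X, l ∈ litsOf A B X := by
  rw [Finset.mem_union]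
  constructor
  · rintro (h | h)
    · exact ⟨.A, h⟩
    · exact ⟨.B, h⟩
  · rintro ⟨_ | _, h⟩
    · exact .inl h
    · exact .inr h

open Classical in
theorem exists_mem_eqns_litsOf {A B : Finset (Literal L)} {e : Sym2 (GTerm L)}
    (h : e ∈ eqns (A ∪ B)) : ∃ X, e ∈ eqns (litsOf A B X) := by
  obtain ⟨s, t, hst, rfl⟩ := h
  obtain ⟨X, hX⟩ := mem_union_iff_exists_litsOf.1 hst
  exact ⟨X, s, t, hX, rfl⟩

open Classical in
theorem exists_colorable_of_mem_termsOf {A B : Finset (Literal L)} {t : GTerm L}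
    (h : t ∈ termsOf (A ∪ B)) : ∃ X, Colorable (litsOf A B X) t := by
  obtain ⟨l, hl, s, hs, hts⟩ := mem_termsOf.1 h
  obtain ⟨X, hX⟩ := mem_union_iff_exists_litsOf.1 hl
  exact ⟨X, (colorable_of_mem_literal hX hs).of_mem_subterms hts⟩

/-! ### Completeness of congruence closure -/

open Classical in
/-- The structure on the connected components of a congruence graph, together with an additional
element `none`. It interprets function symbols in accordance with the vertices of the graph, and by
`none` where these say nothing. Relations are empty. -/
@[reducible]
noncomputable def componentStructure (G : CGraph L) :
    L.Structure (Option G.graph.ConnectedComponent) where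
  funMap {_} f xs :=
    if h : ∃ ts, Term.func f ts ∈ G.verts ∧
        ∀ i, xs i = some (G.graph.connectedComponentMk (ts i)) then
      some (G.graph.connectedComponentMk (Term.func f h.choose))
    else none
  RelMap _ _ := False

/-- If congruence closure cannot proceed, then congruent vertices are connected. So the value of each
vertex is its component. -/
theorem value_componentStructure {E : Set (Sym2 (GTerm L))} {G : CGraph L}
    (hG : SubtermClosed G.verts) (hstuck : ¬ ∃ G', CCStep E G G') {t : GTerm L}
    (ht : t ∈ G.verts) :
    letI := componentStructure G
    value (Option G.graph.ConnectedComponent) t = some (G.graph.connectedComponentMk t) := by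
  let _ := componentStructure G
  induction t with
  | var x => exact x.elim
  | func f ts ih =>
    have h : ∃ ts', Term.func f ts' ∈ G.verts ∧
        ∀ i, value (Option G.graph.ConnectedComponent) (ts i) =
          some (G.graph.connectedComponentMk (ts' i)) :=
      ⟨ts, ht, fun i => ih i (hG.args_mem ht i)⟩
    have heq : value (Option G.graph.ConnectedComponent) (Term.func f ts) =
        some (G.graph.connectedComponentMk (Term.func f h.choose)) := dif_pos h
    rw [heq, Option.some.injEq, SimpleGraph.ConnectedComponent.eq]
    obtain ⟨hmem, hval⟩ := h.choose_spec
    by_contra hr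
    refine hstuck ⟨_, _, hmem, _, ht, ?_, hr, .derived, .inr ⟨rfl, _, f, _, ts, rfl, rfl, ?_⟩, rfl⟩
    · intro he
      exact hr (he ▸ SimpleGraph.Reachable.refl _)
    · intro i
      have := (hval i).symm.trans (ih i (hG.args_mem ht i))
      rwa [Option.some.injEq, SimpleGraph.ConnectedComponent.eq] at this

/-- Otherwise `componentStructure G` is a model of the literals. -/
theorem ccStep_or_reachable {S : Finset (Literal L)} (hS : ¬ (theoryOf S).IsSatisfiable)
    {G : CGraph L} (hV : G.verts = termsOf S) :
    (∃ G', CCStep (eqns S) G G') ∨ ∃ s t, Literal.ne s t ∈ S ∧ G.graph.Reachable s t := by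
  by_contra! hcon
  obtain ⟨hstuck, hne⟩ := hcon
  have hstuck' : ¬ ∃ G', CCStep (eqns S) G G' := fun ⟨G', h⟩ => hstuck G' h
  have hT : SubtermClosed G.verts := hV ▸ subtermClosed_termsOf S
  let _ := componentStructure G
  have hval : ∀ l ∈ S, ∀ t ∈ l.sides, t ∈ G.verts ∧
      value (Option G.graph.ConnectedComponent) t = some (G.graph.connectedComponentMk t) := by
    intro l hl t ht
    have : t ∈ G.verts := hV ▸ mem_termsOf_of_mem_sides hl ht
    exact ⟨this, value_componentStructure hT hstuck' this⟩
  have hM : Option G.graph.ConnectedComponent ⊨ theoryOf S := by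
    refine (model_theoryOf_iff S).2 ⟨fun s t hst => ?_, fun s t hst => ?_⟩
    · obtain ⟨hs, es⟩ := hval _ hst s (by simp [Literal.sides])
      obtain ⟨ht, et⟩ := hval _ hst t (by simp [Literal.sides])
      rw [es, et, Option.some.injEq, SimpleGraph.ConnectedComponent.eq]
      by_contra hr
      refine hstuck' ⟨_, s, hs, t, ht, ?_, hr, .basic, .inl ⟨rfl, s, t, hst, rfl⟩, rfl⟩
      rintro rfl
      exact hr (SimpleGraph.Reachable.refl _)
    · obtain ⟨-, es⟩ := hval _ hst s (by simp [Literal.sides])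
      obtain ⟨-, et⟩ := hval _ hst t (by simp [Literal.sides])
      rw [es, et, Ne, Option.some.injEq, SimpleGraph.ConnectedComponent.eq]
      exact hne s t hst
  exact hS (Theory.Model.isSatisfiable (Option G.graph.ConnectedComponent))

/-! ### Making congruence graphs colorable -/

/-- The initial part of a trace can be replaced with any trace that connects the same vertices. -/
theorem Trace.replace {E : Set (Sym2 (GTerm L))} {V V' : Finset (GTerm L)} (hV : V ⊆ V')
    {a a' b : List (Sym2 (GTerm L) × EdgeKind)} (h : Trace E V (a ++ b)) (ha' : Trace E V' a')
    (haa' : ∀ x y, (edgeGraph a).Reachable x y → (edgeGraph a').Reachable x y) :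
    Trace E V' (a' ++ b) ∧
      ∀ x y, (edgeGraph (a ++ b)).Reachable x y → (edgeGraph (a' ++ b)).Reachable x y := by
  have hreach : ∀ b : List (Sym2 (GTerm L) × EdgeKind), ∀ x y,
      (edgeGraph (a ++ b)).Reachable x y → (edgeGraph (a' ++ b)).Reachable x y := by
    intro b x y hxy
    refine reachable_of_adj_reachable (fun u v huv => ?_) hxy
    obtain ⟨⟨k, hk⟩, -⟩ := edgeGraph_adj.1 huv
    rcases List.mem_append.1 hk with hk | hk
    · exact (haa' u v (reachable_of_mem_edges hk)).mono
        (edgeGraph_mono (List.subset_append_left _ _))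
    · exact reachable_of_mem_edges (List.mem_append_right _ hk)
  refine ⟨?_, hreach b⟩
  induction b using List.reverseRecOn with
  | nil => simpa using ha'
  | append_singleton b e ih =>
    obtain ⟨e, k⟩ := e
    induction e using Sym2.ind with
    | _ x y =>
      rw [← List.append_assoc] at h ⊢
      obtain ⟨htr, hx, hy, hj⟩ := h.mem_and_justified rfl
      exact (ih htr).snoc (hV hx) (hV hy) (hj.mono (hreach b))

theorem Trace.mono {E : Set (Sym2 (GTerm L))} {V V' : Finset (GTerm L)} (hV : V ⊆ V')
    {es : List (Sym2 (GTerm L) × EdgeKind)} (h : Trace E V es) : Trace E V' es :=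
  (Trace.replace (a := []) (a' := []) hV h .nil fun _ _ h => h).1

theorem IsCongruenceGraph.mem_verts_of_reachable {E : Set (Sym2 (GTerm L))} {G : CGraph L}
    (hG : IsCongruenceGraph E G) {x y : GTerm L} (hx : x ∈ G.verts)
    (h : G.graph.Reachable x y) : y ∈ G.verts := by
  obtain ⟨p⟩ := h
  induction p with
  | nil => exact hx
  | cons hadj _ ih =>
    obtain ⟨⟨k, hk⟩, -⟩ := edgeGraph_adj.1 hadj
    exact ih (hG.mem_and_justified hk).2.1

theorem edgeColorable_mk {A B : Finset (Literal L)} {X : Color} {s t : GTerm L}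
    (hs : Colorable (litsOf A B X) s) (ht : Colorable (litsOf A B X) t) :
    EdgeColorable A B s(s, t) := by
  refine ⟨X, fun x hx => ?_⟩
  rcases Sym2.mem_iff.1 hx with rfl | rfl
  · exact hs
  · exact ht

theorem ne_of_not_edgeColorable {A B : Finset (Literal L)} {X Y : Color} {s t : GTerm L}
    (h : ¬ EdgeColorable A B s(s, t)) (hs : Colorable (litsOf A B X) s)
    (ht : Colorable (litsOf A B Y) t) : X ≠ Y := by
  rintro rfl
  exact h (edgeColorable_mk hs ht)

theorem Color.colorable_both {A B : Finset (Literal L)} {X Y : Color} (hXY : X ≠ Y)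
    {t : GTerm L} (hX : Colorable (litsOf A B X) t) (hY : Colorable (litsOf A B Y) t) :
    Colorable A t ∧ Colorable B t := by
  cases X <;> cases Y
  · exact absurd rfl hXY
  · exact ⟨hX, hY⟩
  · exact ⟨hY, hX⟩
  · exact absurd rfl hXY

/-- A walk along colorable edges that leads from an `A`-colorable to a `B`-colorable vertex, or the
other way, visits a vertex that is both. -/
theorem exists_AB_colorable {A B : Finset (Literal L)} {H : SimpleGraph (GTerm L)}
    (hH : ∀ x y, H.Adj x y → EdgeColorable A B s(x, y)) {X Y : Color} (hXY : X ≠ Y)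
    {x y : GTerm L} (p : H.Walk x y) (hx : Colorable (litsOf A B X) x)
    (hy : Colorable (litsOf A B Y) y) :
    ∃ w ∈ p.support, Colorable A w ∧ Colorable B w := by
  induction p with
  | nil => exact ⟨_, by simp, Color.colorable_both hXY hx hy⟩
  | @cons a b _ hadj p ih =>
    obtain ⟨Z, hZ⟩ := hH _ _ hadj
    by_cases hZX : Z = X
    · subst hZX
      obtain ⟨w, hw, h⟩ := ih (hZ b (Sym2.mem_mk_right _ _)) hy
      exact ⟨w, by simp [hw], h⟩
    · exact ⟨a, by simp, Color.colorable_both hZX (hZ a (Sym2.mem_mk_left _ _)) hx⟩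

open Classical in
/-- The number of edges that are not colorable. -/
noncomputable def numUncolorable (A B : Finset (Literal L)) (G : CGraph L) : ℕ :=
  G.edges.countP fun e => ¬ EdgeColorable A B e.1

open Classical in
theorem exists_splitStep {A B : Finset (Literal L)} {G : CGraph L}
    (hG : IsCongruenceGraph (eqns (A ∪ B)) G)
    (hV : ∀ v ∈ G.verts, ∃ X, Colorable (litsOf A B X) v)
    (h : ∃ e ∈ G.edges, ¬ EdgeColorable A B e.1) : ∃ G', SplitStep A B G G' := by
  obtain ⟨es₁, ⟨e, k⟩, es₂, hes, he, hfirst⟩ := exists_first h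
  induction e using Sym2.ind with
  | _ s t =>
    obtain ⟨-, hs, ht, hj⟩ := hG.trace.mem_and_justified hes
    rcases hj with ⟨-, hE⟩ | ⟨rfl, n, f, us, vs, rfl, rfl, hr⟩
    · obtain ⟨X, hX⟩ := exists_mem_eqns_litsOf hE
      exact absurd ⟨X, fun x hx => colorable_of_mem_eqns hX hx⟩ he
    · obtain ⟨X, hX⟩ := hV _ hs
      obtain ⟨Y, hY⟩ := hV _ ht
      have hXY : X ≠ Y := ne_of_not_edgeColorable he hX hY
      have hle : edgeGraph es₁ ≤ G.graph :=
        edgeGraph_mono (hes ▸ List.subset_append_left _ _)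
      have hw : ∀ i, ∃ w, ∃ π, IsPathBetween G (us i) (vs i) π ∧ w ∈ π ∧
          Colorable A w ∧ Colorable B w := by
        intro i
        obtain ⟨p, hp⟩ := (hr i).exists_isPath
        obtain ⟨w, hw, hwAB⟩ := exists_AB_colorable (A := A) (B := B) (fun x y hxy => by
            obtain ⟨⟨k, hk⟩, -⟩ := edgeGraph_adj.1 hxy
            exact not_not.1 (hfirst _ hk)) hXY p
          ((colorable_func_iff.1 hX).2 i) ((colorable_func_iff.1 hY).2 i)
        refine ⟨w, p.support, ⟨p.mapLe hle, hp.mapLe hle, ?_⟩, hw, hwAB⟩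
        simp [SimpleGraph.Walk.mapLe]
      choose ws hws using hw
      exact ⟨_, es₁, es₂, n, f, us, vs, ws, hes, fun e he' => not_not.1 (hfirst e he'), he, hws,
        rfl⟩

open Classical in
/-- Splitting an edge results in a congruence graph on a larger set of terms, which has fewer
uncolorable edges: the head symbol of the edge and the chosen arguments are shared, so that the new
vertex has both colors and the two new edges are colorable. -/
theorem SplitStep.spec {A B : Finset (Literal L)} {G G' : CGraph L}
    (hG : IsCongruenceGraph (eqns (A ∪ B)) G)
    (hV : ∀ v ∈ G.verts, ∃ X, Colorable (litsOf A B X) v) (h : SplitStep A B G G') :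
    IsCongruenceGraph (eqns (A ∪ B)) G' ∧
      (∀ v ∈ G'.verts, ∃ X, Colorable (litsOf A B X) v) ∧
      (∀ x y, G.graph.Reachable x y → G'.graph.Reachable x y) ∧
      numUncolorable A B G' < numUncolorable A B G := by
  obtain ⟨es₁, es₂, n, f, us, vs, ws, hes, -, hunc, hws, rfl⟩ := h
  obtain ⟨htr₁, hus, hvs, hj⟩ := hG.trace.mem_and_justified hes
  have hsub : es₁ ⊆ G.edges := hes ▸ List.subset_append_left _ _
  obtain ⟨X, hX⟩ := hV _ hus
  obtain ⟨Y, hY⟩ := hV _ hvs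
  have hXY : X ≠ Y := ne_of_not_edgeColorable hunc hX hY
  have hr : ∀ i, (edgeGraph es₁).Reachable (us i) (ws i) ∧
      (edgeGraph es₁).Reachable (ws i) (vs i) := by
    intro i
    obtain ⟨π, hπ, hw, -⟩ := hws i
    exact (hπ.pathIn_of_reachable hG.isAcyclic hsub (hj.reachable_args i)).2 _ hw
  have hwX : ∀ Z, Colorable (litsOf A B Z) (Term.func f ws) := by
    have hf : Sum.inl ⟨n, f⟩ ∈ symbolsOf (litsOf A B X) ∧
        Sum.inl ⟨n, f⟩ ∈ symbolsOf (litsOf A B Y) :=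
      ⟨(colorable_func_iff.1 hX).1, (colorable_func_iff.1 hY).1⟩
    intro Z
    have hw : ∀ i, Colorable A (ws i) ∧ Colorable B (ws i) := fun i => (hws i).choose_spec.2.2
    refine colorable_func_iff.2 ⟨?_, fun i => ?_⟩
    · cases X <;> cases Y <;> cases Z <;> first | exact absurd rfl hXY | exact hf.1 | exact hf.2
    · cases Z
      · exact (hw i).1
      · exact (hw i).2
  have hVV : G.verts ⊆ insert (Term.func f ws) G.verts := Finset.subset_insert _ _
  set e₁ : Sym2 (GTerm L) × EdgeKind := (s(Term.func f us, Term.func f ws), .derived) with he₁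
  set e₂ : Sym2 (GTerm L) × EdgeKind := (s(Term.func f ws, Term.func f vs), .derived) with he₂
  have htr : Trace (eqns (A ∪ B)) (insert (Term.func f ws) G.verts) (es₁ ++ [e₁] ++ [e₂]) := by
    refine ((htr₁.mono hVV).snoc (hVV hus) (Finset.mem_insert_self _ _) ?_).snoc
      (Finset.mem_insert_self _ _) (hVV hvs) ?_
    · exact .inr ⟨rfl, n, f, us, ws, rfl, rfl, fun i => (hr i).1⟩
    · exact .inr ⟨rfl, n, f, ws, vs, rfl, rfl, fun i =>
        (hr i).2.mono (edgeGraph_mono (List.subset_append_left _ _))⟩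
  have hG' := hG.trace
  rw [hes, ← List.singleton_append, ← List.append_assoc] at hG'
  obtain ⟨htrace, hreach⟩ := hG'.replace hVV htr fun x y hxy => by
    refine reachable_of_adj_reachable (fun u v huv => ?_) hxy
    obtain ⟨⟨k, hk⟩, -⟩ := edgeGraph_adj.1 huv
    rcases List.mem_append.1 hk with hk | hk
    · exact reachable_of_mem_edges (k := k) (by simp [hk])
    · rw [List.mem_singleton, Prod.mk.injEq] at hk
      have h12 : (edgeGraph (es₁ ++ [e₁] ++ [e₂])).Reachable (Term.func f us)
          (Term.func f vs) :=
        (reachable_of_mem_edges (y := Term.func f ws) (k := .derived) (by simp [he₁])).trans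
          (reachable_of_mem_edges (k := .derived) (by simp [he₂]))
      rcases Sym2.eq_iff.1 hk.1 with ⟨rfl, rfl⟩ | ⟨rfl, rfl⟩
      · exact h12
      · exact h12.symm
  have hlist : es₁ ++ e₁ :: e₂ :: es₂ = es₁ ++ [e₁] ++ [e₂] ++ es₂ := by simp
  have hcol : EdgeColorable A B e₁.1 ∧ EdgeColorable A B e₂.1 :=
    ⟨edgeColorable_mk hX (hwX X), edgeColorable_mk (hwX Y) hY⟩
  refine ⟨⟨?_, ?_⟩, ?_, fun x y hxy => ?_, ?_⟩
  · intro t ht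
    rcases Finset.mem_insert.1 ht with rfl | ht
    · intro r hr'
      rcases mem_subterms_func.1 hr' with rfl | ⟨i, hi⟩
      · exact Finset.mem_insert_self _ _
      · refine hVV (hG.1 _ ?_ hi)
        exact hG.mem_verts_of_reachable (hG.1.args_mem hus i)
          ((hr i).1.mono (edgeGraph_mono hsub))
    · exact (hG.1 t ht).trans hVV
  · rw [hlist]
    exact htrace.steps_prune
  · intro v hv
    rcases Finset.mem_insert.1 hv with rfl | hv
    · exact ⟨X, hwX X⟩
    · exact hV v hv
  · rw [CGraph.graph, hlist, reachable_prune_iff]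
    refine hreach x y ?_
    rw [CGraph.graph, hes] at hxy
    simpa using hxy
  · refine ((prune_sublist _).countP_le).trans_lt ?_
    rw [numUncolorable, hes]
    simp [hcol.1, hcol.2, hunc]

open Classical in
theorem exists_isColoring {A B : Finset (Literal L)} {G : CGraph L}
    (hG : IsCongruenceGraph (eqns (A ∪ B)) G) (h : ∀ e ∈ G.edges, EdgeColorable A B e.1) :
    ∃ c, IsColoring A B G c := by
  -- An edge that is an equation of the input is colored as such, even if it is a derived edge.
  have key : ∀ e : Sym2 (GTerm L), ∃ X, ∀ k, (e, k) ∈ G.edges →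
      (k = .basic → e ∈ eqns (litsOf A B X)) ∧ ∀ x ∈ e, Colorable (litsOf A B X) x := by
    intro e
    by_cases he : e ∈ eqns (A ∪ B)
    · obtain ⟨X, hX⟩ := exists_mem_eqns_litsOf he
      exact ⟨X, fun k _ => ⟨fun _ => hX, fun x hx => colorable_of_mem_eqns hX hx⟩⟩
    · by_cases hk : ∃ k, (e, k) ∈ G.edges
      · obtain ⟨k, hk⟩ := hk
        obtain ⟨X, hX⟩ := h _ hk
        refine ⟨X, fun k' hk' => ⟨?_, hX⟩⟩
        rintro rfl
        induction e using Sym2.ind with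
        | _ x y =>
          rcases (hG.mem_and_justified hk').2.2 with ⟨-, h⟩ | ⟨h, -⟩
          · exact absurd h he
          · cases h
      · exact ⟨.A, fun k hk' => absurd ⟨k, hk'⟩ hk⟩
  choose c hc using key
  exact ⟨c, fun e k hk => hc e k hk⟩

/-! ### Runs of the algorithm -/

open Classical in
/-- The property of the states that can be reached. -/
def Invariant (A B : Finset (Literal L)) : State L → Prop
  | .closing G => IsCongruenceGraph (eqns (A ∪ B)) G ∧ G.verts = termsOf (A ∪ B)
  | .splitting G s t X => IsCongruenceGraph (eqns (A ∪ B)) G ∧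
      (∀ v ∈ G.verts, ∃ X, Colorable (litsOf A B X) v) ∧ Literal.ne s t ∈ litsOf A B X ∧
      G.graph.Reachable s t
  | .colored G c s t X => IsCongruenceGraph (eqns (A ∪ B)) G ∧ IsColoring A B G c ∧
      Literal.ne s t ∈ litsOf A B X ∧ G.graph.Reachable s t
  | .returned φ => IsInterpolant A B φ ∧ IsHornConj φ

open Classical in
/-- The number of pairs of vertices that are not connected. -/
noncomputable def numUnconnected (G : CGraph L) : ℕ :=
  ((G.verts ×ˢ G.verts).filter fun p => ¬ G.graph.Reachable p.1 p.2).card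

/-- A measure that decreases in each step: the remaining phases of the algorithm, and the work that
is left to do in the current phase. -/
noncomputable def rank (A B : Finset (Literal L)) : State L → ℕ ×ₗ ℕ
  | .closing G => toLex (3, numUnconnected G)
  | .splitting G _ _ _ => toLex (2, numUncolorable A B G)
  | .colored _ _ _ _ _ => toLex (1, 0)
  | .returned _ => toLex (0, 0)

theorem CCStep.numUnconnected_lt {E : Set (Sym2 (GTerm L))} {G G' : CGraph L}
    (h : CCStep E G G') : numUnconnected G' < numUnconnected G := by
  obtain ⟨s, hs, t, ht, -, hst, k, -, rfl⟩ := h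
  refine Finset.card_lt_card (Finset.ssubset_iff_of_subset ?_ |>.2 ⟨(s, t), ?_, ?_⟩)
  · intro p hp
    simp only [Finset.mem_filter] at hp ⊢
    exact ⟨hp.1, fun h => hp.2 (h.mono (edgeGraph_mono (List.subset_append_left _ _)))⟩
  · simp [hs, ht, hst]
  · simp only [Finset.mem_filter, not_and, not_not]
    exact fun _ => reachable_of_mem_edges (k := k) (by simp)

theorem CCStep.verts_eq {E : Set (Sym2 (GTerm L))} {G G' : CGraph L} (h : CCStep E G G') :
    G'.verts = G.verts := by
  obtain ⟨s, hs, t, ht, -, hst, k, -, rfl⟩ := h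
  rfl

theorem Step.invariant_and_rank_lt {A B : Finset (Literal L)} {q q' : State L}
    (h : Step A B q q') (hq : Invariant A B q) :
    Invariant A B q' ∧ rank A B q' < rank A B q := by
  cases h with
  | close G G' h =>
    refine ⟨⟨⟨h.verts_eq ▸ hq.1.1, ?_⟩, h.verts_eq.trans hq.2⟩, ?_⟩
    · rw [h.verts_eq]
      exact hq.1.2.tail h
    · exact Prod.Lex.toLex_lt_toLex.2 (.inr ⟨rfl, h.numUnconnected_lt⟩)
  | found G s t X hst h =>
    refine ⟨⟨hq.1, fun v hv => exists_colorable_of_mem_termsOf (hq.2 ▸ hv), hst, h⟩, ?_⟩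
    exact Prod.Lex.toLex_lt_toLex.2 (.inl (by norm_num))
  | split G G' s t X h =>
    obtain ⟨h₁, h₂, h₃, h₄⟩ := h.spec hq.1 hq.2.1
    exact ⟨⟨h₁, h₂, hq.2.2.1, h₃ _ _ hq.2.2.2⟩, Prod.Lex.toLex_lt_toLex.2 (.inr ⟨rfl, h₄⟩)⟩
  | color G c s t X h =>
    exact ⟨⟨hq.1, h, hq.2.2⟩, Prod.Lex.toLex_lt_toLex.2 (.inl (by norm_num))⟩
  | ret G c s t X φ h =>
    exact ⟨h.isInterpolant hq.1 hq.2.1 hq.2.2.1,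
      Prod.Lex.toLex_lt_toLex.2 (.inl (by norm_num))⟩

theorem invariant_start (A B : Finset (Literal L)) : Invariant A B (start A B) :=
  ⟨⟨subtermClosed_termsOf _, .refl⟩, rfl⟩

theorem Reaches.invariant {A B : Finset (Literal L)} {q : State L} (h : Reaches A B q) :
    Invariant A B q := by
  induction h with
  | refl => exact invariant_start A B
  | tail _ hstep ih => exact (hstep.invariant_and_rank_lt ih).1

open Classical in
theorem exists_step_or_returned {A B : Finset (Literal L)}
    (hAB : ¬ (theoryOf (A ∪ B)).IsSatisfiable) {q : State L} (hq : Invariant A B q) :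
    (∃ q', Step A B q q') ∨ ∃ φ, q = .returned φ := by
  cases q with
  | closing G =>
    refine .inl ?_
    rcases ccStep_or_reachable hAB hq.2 with ⟨G', h⟩ | ⟨s, t, hst, h⟩
    · exact ⟨_, .close G G' h⟩
    · obtain ⟨X, hX⟩ := mem_union_iff_exists_litsOf.1 hst
      exact ⟨_, .found G s t X hX h⟩
  | splitting G s t X =>
    refine .inl ?_
    by_cases h : ∃ e ∈ G.edges, ¬ EdgeColorable A B e.1
    · obtain ⟨G', h⟩ := exists_splitStep hq.1 hq.2.1 h
      exact ⟨_, .split G G' s t X h⟩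
    · push Not at h
      obtain ⟨c, hc⟩ := exists_isColoring hq.1 h
      exact ⟨_, .color G c s t X hc⟩
  | colored G c s t X =>
    obtain ⟨φ, hφ⟩ := exists_returns (B := B) hq.1 c hq.2.2.2 X
    exact .inl ⟨_, .ret G c s t X φ hφ⟩
  | returned φ => exact .inr ⟨φ, rfl⟩

theorem not_exists_infinite_run (A B : Finset (Literal L)) :
    ¬ ∃ run : ℕ → State L, run 0 = start A B ∧ ∀ n, Step A B (run n) (run (n + 1)) := by
  rintro ⟨run, h0, hstep⟩
  have hinv : ∀ n, Invariant A B (run n) := by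
    intro n
    induction n with
    | zero => exact h0 ▸ invariant_start A B
    | succ n ih => exact ((hstep n).invariant_and_rank_lt ih).1
  obtain ⟨n, hn⟩ := WellFounded.not_rel_apply_succ (r := (· < ·)) fun n => rank A B (run n)
  exact hn ((hstep n).invariant_and_rank_lt (hinv n)).2

end EUF

open Classical in
/-- The ground interpolation algorithm for the theory of equality is totally correct. -/
theorem mainTheorem1 {L : FirstOrder.Language.{u, v}} (A B : Finset (EUF.Literal L))
    (hAB : ¬ (EUF.theoryOf (A ∪ B)).IsSatisfiable) :
    -- Termination: there is no infinite run.
    (¬ ∃ run : ℕ → EUF.State L, run 0 = EUF.start A B ∧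
      ∀ n, EUF.Step A B (run n) (run (n + 1))) ∧
    -- A run stops only by returning a formula.
    (∀ q, EUF.Reaches A B q → (∃ q', EUF.Step A B q q') ∨ ∃ φ, q = .returned φ) ∧
    -- Every formula that a run returns is an interpolant and a conjunction of Horn clauses.
    (∀ φ, EUF.Reaches A B (.returned φ) → EUF.IsInterpolant A B φ ∧ EUF.IsHornConj φ) ∧
    -- The same holds for any other way of obtaining a colored congruence graph.
    (∀ (G : EUF.CGraph L) (c : Sym2 (EUF.GTerm L) → EUF.Color) (s t : EUF.GTerm L)
      (X : EUF.Color), EUF.IsCongruenceGraph (EUF.eqns (A ∪ B)) G → EUF.IsColoring A B G c →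
      EUF.Literal.ne s t ∈ EUF.litsOf A B X → G.graph.Reachable s t →
      (∃ φ, EUF.Returns B G c s t X φ) ∧
      ∀ φ, EUF.Returns B G c s t X φ → EUF.IsInterpolant A B φ ∧ EUF.IsHornConj φ) := by
  refine ⟨EUF.not_exists_infinite_run A B, fun q hq => ?_, fun φ hφ => hφ.invariant, ?_⟩
  · exact EUF.exists_step_or_returned hAB hq.invariant
  · intro G c s t X hG hc hst hr
    exact ⟨EUF.exists_returns hG c hr X, fun φ hφ => hφ.isInterpolant hG hc hst⟩
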